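/- Let $S$ be a closed connected orientable surface (for instance of genus $g\ge 2$), let $p:\tilde S\to S$ be its universal covering and let $\Gamma\cong\pi_1(S)$ be the group of deck transformations of $p$. Let $\mathcal T$ be a triangulation of $S$, that is, a presentation of $S$ as the quotient of finitely many triangles by a gluing of their sides in pairs (different vertices or sides of a triangle may become equal in $S$, so that e.g. triangulations with a single vertex are allowed). Let $\tilde{\mathcal T}$ be its lift to $\tilde S$ and $\tilde V$ the set of vertices of $\tilde{\mathcal T}$. Let $X$ be a complete $\mathrm{CAT}(-1)$ metric space and let $\rho:\Gamma\to\mathrm{Isom}(X)$ be a representation. For a $\rho$-equivariant map $F:\tilde V\to X$ and an edge $e$ of $\tilde{\mathcal T}$ with endpoints $e_-,e_+$ put $\ell_F(e)=d_X(F(e_-),F(e_+))$. The energy of $F$ is $\mathcal E(F)=\sum_{e\in E_0}\ell_F(e)^2$, where $E_0$ contains exactly one lift of every edge of $\mathcal T$, and $F$ is called harmonic if $\mathcal E(F)\le\mathcal E(G)$ for all $\rho$-equivariant maps $G:\tilde V\to X$. We say that $F$ flattens an edge $e$ if $\ell_F(e)=0$. Let $F:\tilde V\to X$ be a harmonic $\rho$-equivariant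 map that flattens no edge, and let $x\in\tilde V$. Let $(y_i)$ be the cyclically ordered neighbours of $x$ in $\tilde{\mathcal T}$ (listed once for every edge issuing from $x$, so that the triangles around $x$ are the triangles $[x,y_i,y_{i+1}]$, with $i$ taken cyclically), and let $\alpha_i=\angle_{F(x)}(F(y_i),F(y_{i+1}))$ be the Alexandrov angle at $F(x)$ between the geodesics $[F(x)F(y_i)]$ and $[F(x)F(y_{i+1})]$. Then $$\sum_i\alpha_i\ \ge\ 2\pi .$$ -/

import Mathlib

open Filter Topology

noncomputable section

/-! ## Metric geometry: geodesics, CAT(-1) spaces, Alexandrov angles -/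

section MetricGeometry

variable {X : Type*} [MetricSpace X]

/-- `c`, restricted to `[0, dist x y]`, is a geodesic (an isometric embedding) from `x` to `y`. -/
def IsGeodesicFromTo (c : ℝ → X) (x y : X) : Prop :=
  c 0 = x ∧ c (dist x y) = y ∧
    ∀ s ∈ Set.Icc 0 (dist x y), ∀ t ∈ Set.Icc 0 (dist x y), dist (c s) (c t) = |s - t|

/-- A CAT(-1) space: a geodesic space such that, for every geodesic triangle, the comparison map
from the comparison triangle in the hyperbolic plane is 1-Lipschitz. The triangle has vertices
`x 0`, `x 1`, `x 2`, and its `i`-th side `c i` joins `x i` to `x (i + 1)` (indices modulo 3).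
Mathlib's distance on the upper half-plane is the hyperbolic distance of curvature `-1`. -/
structure IsCATNegOne (X : Type*) [MetricSpace X] : Prop where
  exists_geodesic : ∀ x y : X, ∃ c : ℝ → X, IsGeodesicFromTo c x y
  comparison : ∀ (x : Fin 3 → X) (c : Fin 3 → ℝ → X),
    (∀ i, IsGeodesicFromTo (c i) (x i) (x (i + 1))) →
    ∃ (x' : Fin 3 → UpperHalfPlane) (c' : Fin 3 → ℝ → UpperHalfPlane),
      (∀ i, dist (x' i) (x' (i + 1)) = dist (x i) (x (i + 1))) ∧
      (∀ i, IsGeodesicFromTo (c' i) (x' i) (x' (i + 1))) ∧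
      ∀ i j, ∀ s ∈ Set.Icc 0 (dist (x i) (x (i + 1))), ∀ t ∈ Set.Icc 0 (dist (x j) (x (j + 1))),
        dist (c i s) (c j t) ≤ dist (c' i s) (c' j t)

/-- The angle at `x` of the Euclidean comparison triangle of `x, y, z` (law of cosines). -/
def comparisonAngle (x y z : X) : ℝ :=
  Real.arccos ((dist x y ^ 2 + dist x z ^ 2 - dist y z ^ 2) / (2 * dist x y * dist x z))

/-- The Alexandrov angle of two geodesics `c₁, c₂` issuing from the same point. In a CAT(-1) space
the comparison angles decrease as `t` decreases to `0`, so that the upper limit is a limit. -/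
def geodesicAngle (c₁ c₂ : ℝ → X) : ℝ :=
  limsup (fun t : ℝ => comparisonAngle (c₁ 0) (c₁ t) (c₂ t)) (𝓝[>] 0)

open Classical in
/-- The geodesic `[xy]` (unique in a CAT(-1) space; constant if there is none). -/
def geodesicSegment (x y : X) : ℝ → X :=
  if h : ∃ c : ℝ → X, IsGeodesicFromTo c x y then h.choose else fun _ => x

/-- The Alexandrov angle `∠ₓ(y, z)` between `[xy]` and `[xz]`. -/
def alexandrovAngle (x y z : X) : ℝ :=
  geodesicAngle (geodesicSegment x y) (geodesicSegment x z)

end MetricGeometry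

/-! ## Triangulated surfaces -/

/-- The standard closed triangle. -/
abbrev StdTriangle : Type := stdSimplex ℝ (Fin 3)

/-- The `i`-th vertex of the standard triangle. -/
abbrev triangleVertex (i : Fin 3) : StdTriangle := stdSimplex.vertex i

/-- The point `(1 - t) vᵢ + t vᵢ₊₁` of the `i`-th side of the standard triangle; this side joins
the `i`-th vertex to the next one (indices modulo 3). -/
def sidePoint (i : Fin 3) (t : unitInterval) : StdTriangle :=
  ⟨(1 - (t : ℝ)) • Pi.single i 1 + (t : ℝ) • Pi.single (i + 1) 1,
    convex_stdSimplex ℝ (Fin 3) (single_mem_stdSimplex ℝ i) (single_mem_stdSimplex ℝ (i + 1))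
      (sub_nonneg.2 t.2.2) t.2.1 (by ring)⟩

/-- Elementary identifications in a disjoint union of triangles whose sides are matched by `opp`:
side `d` is glued to side `opp d` affinely, reversing the direction of the sides. -/
inductive SideGlued {Face : Type*} (opp : Face × Fin 3 → Face × Fin 3) :
    Face × StdTriangle → Face × StdTriangle → Prop
  | glue (d : Face × Fin 3) (t : unitInterval) :
      SideGlued opp (d.1, sidePoint d.2 t)
        ((opp d).1, sidePoint (opp d).2 (unitInterval.symm t))

/-- A triangulation, with set of faces `Face`, of a surface `S`. Every face is parametrized by the
standard triangle, positively for an orientation of `S`; the sides of the faces are matched in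
pairs by `opp`; and `S` is exactly what results from gluing the matched sides (each reversing the
direction, as the parametrizations are positive). As usual for triangulations of surfaces with few
vertices, different vertices of a face may coincide in `S`, and so may different sides. -/
structure SurfaceTriangulation (S : Type*) [TopologicalSpace S] (Face : Type*) where
  charMap : Face → C(StdTriangle, S)
  opp : Face × Fin 3 → Face × Fin 3
  opp_opp : ∀ d, opp (opp d) = d
  opp_ne : ∀ d, opp d ≠ d
  surjective : ∀ s : S, ∃ f a, charMap f a = s
  charMap_eq_iff : ∀ f a g b,
    charMap f a = charMap g b ↔ Relation.EqvGen (SideGlued opp) (f, a) (g, b)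

/-- The group of deck transformations of `p : S' → S`. For a universal covering of a connected
surface `S` this is the fundamental group of `S`, acting on the universal cover. -/
def DeckGroup {S' S : Type*} [TopologicalSpace S'] (p : S' → S) : Subgroup (S' ≃ₜ S') where
  carrier := {h | ∀ z, p (h z) = p z}
  mul_mem' := by
    intro a b ha hb z
    rw [Homeomorph.mul_apply, ha, hb]
  one_mem' := by
    intro z
    rfl
  inv_mem' := by
    intro a ha z
    have h := ha (a⁻¹ z)
    rw [← Homeomorph.mul_apply, mul_inv_cancel] at h
    exact h.symm

namespace SurfaceTriangulation

variable {S S' Face : Type*} [TopologicalSpace S] [TopologicalSpace S']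
variable (T : SurfaceTriangulation S Face) (p : S' → S)

/-- The vertices of the lifted triangulation of `S'`: the points over the vertices of `T`. -/
def LiftedVertex : Type _ :=
  {z : S' // ∃ f i, T.charMap f (triangleVertex i) = p z}

/-- The faces of the lifted triangulation over the face `f`: the lifts of its parametrization. -/
def LiftedFace (f : Face) : Type _ :=
  {σ : C(StdTriangle, S') // ∀ a, p (σ a) = T.charMap f a}

variable {T p}

/-- The `i`-th vertex of a lifted face. -/
def LiftedFace.vertex {f : Face} (σ : T.LiftedFace p f) (i : Fin 3) : T.LiftedVertex p :=
  ⟨σ.1 (triangleVertex i), f, i, (σ.2 _).symm⟩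

/-- The action of deck transformations on the vertices of the lifted triangulation. -/
def LiftedVertex.deck (h : DeckGroup p) (z : T.LiftedVertex p) : T.LiftedVertex p :=
  ⟨h.1 z.1, by obtain ⟨f, i, hz⟩ := z.2; exact ⟨f, i, hz.trans (h.2 z.1).symm⟩⟩

variable {X : Type*} [MetricSpace X]

/-- `F` is equivariant with respect to the representation `ρ`. -/
def IsEquivariant (ρ : DeckGroup p →* (X ≃ᵢ X)) (F : T.LiftedVertex p → X) : Prop :=
  ∀ (h : DeckGroup p) (z : T.LiftedVertex p), F (z.deck h) = ρ h (F z)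

/-- The length `ℓ_F` of the `i`-th side of a lifted face. -/
def sideLength (F : T.LiftedVertex p → X) {f : Face} (σ : T.LiftedFace p f) (i : Fin 3) : ℝ :=
  dist (F (σ.vertex i)) (F (σ.vertex (i + 1)))

variable (T p) in
/-- A fundamental domain for the deck transformations on the faces: a lift of every face. -/
abbrev FundamentalDomain : Type _ := ∀ f : Face, T.LiftedFace p f

/-- The energy of an equivariant map: the sum of the squared lengths of the edges, one edge for
every edge of `T`. Every edge of `T` is a side in exactly two ways, hence the factor `1 / 2`;
the choice of the lifts is irrelevant by equivariance. -/
def energy [Fintype Face] (D : T.FundamentalDomain p) (F : T.LiftedVertex p → X) : ℝ :=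
  (1 / 2) * ∑ f, ∑ i : Fin 3, sideLength F (D f) i ^ 2

/-- Harmonic equivariant maps: those of least energy among all equivariant maps. -/
def IsHarmonic [Fintype Face] (D : T.FundamentalDomain p) (ρ : DeckGroup p →* (X ≃ᵢ X))
    (F : T.LiftedVertex p → X) : Prop :=
  IsEquivariant ρ F ∧ ∀ G : T.LiftedVertex p → X, IsEquivariant ρ G → energy D F ≤ energy D G

/-- `F` flattens no edge of the lifted triangulation: no edge has length `0`. -/
def FlattensNoEdge (F : T.LiftedVertex p → X) : Prop :=
  ∀ (f : Face) (σ : T.LiftedFace p f) (i : Fin 3), sideLength F σ i ≠ 0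

/-- A corner of the lifted triangulation at the vertex `x`: a lifted face with a distinguished
vertex that is equal to `x`. -/
structure Corner (x : T.LiftedVertex p) where
  face : Face
  lift : T.LiftedFace p face
  idx : Fin 3
  vertex_eq : lift.vertex idx = x

/-- The corners `κ` at `x` correspond to the edges issuing from `x`, in cyclic order: the neighbour
at the end of the edge that belongs to `κ` is `κ.neighbour`. -/
def Corner.neighbour {x : T.LiftedVertex p} (κ : Corner x) : T.LiftedVertex p :=
  κ.lift.vertex (κ.idx + 1)

/-- The neighbour of `x` that follows `κ.neighbour` in the cyclic order around `x`: the third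
vertex of the face. -/
def Corner.nextNeighbour {x : T.LiftedVertex p} (κ : Corner x) : T.LiftedVertex p :=
  κ.lift.vertex (κ.idx + 2)

/-- For a covering map there are only finitely many corners at a vertex. -/
theorem finite_corner [Finite Face] (hp : IsCoveringMap p) (x : T.LiftedVertex p) :
    Finite (Corner x) := by
  have : PreconnectedSpace StdTriangle :=
    isPreconnected_iff_preconnectedSpace.1 (convex_stdSimplex ℝ (Fin 3)).isPreconnected
  refine Finite.of_injective (fun κ : Corner x => (κ.face, κ.idx)) ?_
  rintro ⟨f, σ, i, h⟩ ⟨g, τ, j, h'⟩ e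
  obtain ⟨rfl, rfl⟩ := Prod.mk.inj e
  have hv : σ.1 (triangleVertex i) = τ.1 (triangleVertex i) :=
    congrArg Subtype.val (h.trans h'.symm)
  have hστ : σ = τ := Subtype.ext (DFunLike.coe_injective
    (hp.eq_of_comp_eq σ.1.continuous τ.1.continuous
      (funext fun a => (σ.2 a).trans (τ.2 a).symm) _ hv))
  subst hστ
  rfl

/-- The sum of the angles `∠_{F x}(F yᵢ, F yᵢ₊₁)` over the pairs of consecutive neighbours of
`x`. -/
def angleSum (F : T.LiftedVertex p → X) (x : T.LiftedVertex p) : ℝ :=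
  ∑ᶠ κ : Corner x, alexandrovAngle (F x) (F κ.neighbour) (F κ.nextNeighbour)

end SurfaceTriangulation

end

/-! Push the value of F at x, together with its orbit, along the geodesic towards a point y. By the
first variation inequality of CAT(-1) geometry, the edge from F x to F yᵢ shrinks at rate at least
cos ∠(y, F yᵢ). Since F minimizes the energy, ∑ ℓᵢ cos ∠(y, F yᵢ) ≤ 0 for every y ≠ F x
(`IsHarmonic.sum_mul_cos_nonpos`); the choices y = F yⱼ say that the directions of the edges at F x,
weighted by their lengths, are balanced.

The conclusion then concerns directions only (`two_pi_le_sum_of_balanced`). Angles satisfy the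
triangle inequality, so consecutive directions form a closed polygon whose perimeter L is the angle
sum. Suppose L < 2π and lay the polygon out along a circle of length L, with positions tᵢ. The angle
Aᵢⱼ is at most either arc, hence cos Aᵢⱼ ≥ cos (tᵢ - tⱼ) and ∑ ℓᵢ ℓⱼ cos Aᵢⱼ ≥ |∑ ℓᵢ exp(i tᵢ)|² ≥
0. Balance makes the left side nonpositive, so equality holds everywhere. As L < 2π, this confines
the tᵢ to an interval shorter than π, where a positive combination of the vectors exp(i tᵢ) cannot
vanish.

The comparison axiom enters only through Stewart's inequality (`sinh_mul_cosh_dist_le`), which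
yields monotonicity of comparison angles and with it the existence of angles, their triangle
inequality and the first variation. The topological input is that the corners at x form a single
cycle (`Corner.exists_rotation`). -/

noncomputable section

/-! ## Hyperbolic trigonometry -/

/-- A vector orthogonal to a timelike vector for the Lorentzian form `a c - b ^ 2` and isotropic
vanishes. -/
theorem eq_zero_of_isotropic_of_orthogonal {a b c A B C : ℝ} (hm : A * C - B ^ 2 = 1)
    (ho : a * C + c * A = 2 * (b * B)) (hi : a * c = b ^ 2) : a = 0 ∧ b = 0 ∧ c = 0 := by
  have h1 : (a * C - c * A) ^ 2 + 4 * b ^ 2 = 0 := by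
    have : (a * C - c * A) ^ 2 = (a * C + c * A) ^ 2 - 4 * (a * c) * (A * C) := by ring
    rw [this, ho, hi, show A * C = 1 + B ^ 2 by linarith]
    ring
  have hb : b = 0 := by nlinarith [sq_nonneg (a * C - c * A), sq_nonneg b]
  subst hb
  have h2 : a * C - c * A = 0 := by nlinarith [sq_nonneg (a * C - c * A)]
  have hAC : A * C ≠ 0 := by nlinarith [sq_nonneg B]
  have haC : a * C = 0 := by linarith
  have hcA : c * A = 0 := by linarith
  exact ⟨(mul_eq_zero.1 haC).resolve_right (right_ne_zero_of_mul hAC), rfl,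
    (mul_eq_zero.1 hcA).resolve_right (left_ne_zero_of_mul hAC)⟩

/-- The hyperbolic distance as a Lorentzian product in the hyperboloid model. -/
theorem UpperHalfPlane.cosh_dist_eq_lorentz (z w : UpperHalfPlane) :
    Real.cosh (dist z w) = ((1 / z.im) * ((w.re ^ 2 + w.im ^ 2) / w.im) +
      ((z.re ^ 2 + z.im ^ 2) / z.im) * (1 / w.im)) / 2 - (z.re / z.im) * (w.re / w.im) := by
  have hz := z.im_pos
  have hw := w.im_pos
  rw [UpperHalfPlane.cosh_dist']
  field_simp
  ring

/-- Stewart's theorem in the hyperbolic plane. -/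
theorem UpperHalfPlane.sinh_mul_cosh_dist {x y m : UpperHalfPlane} {s D : ℝ}
    (hxm : dist x m = s) (hmy : dist m y = D - s) (hxy : dist x y = D) (q : UpperHalfPlane) :
    Real.sinh D * Real.cosh (dist q m) =
      Real.sinh (D - s) * Real.cosh (dist q x) + Real.sinh s * Real.cosh (dist q y) := by
  have hxm' := x.cosh_dist_eq_lorentz m
  have hmy' := m.cosh_dist_eq_lorentz y
  have hxy' := x.cosh_dist_eq_lorentz y
  have unit : ∀ z : UpperHalfPlane,
      (1 / z.im) * ((z.re ^ 2 + z.im ^ 2) / z.im) - (z.re / z.im) ^ 2 = 1 := by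
    intro z
    have hz := z.im_pos
    field_simp
    ring
  rw [hxm] at hxm'
  rw [hmy] at hmy'
  rw [hxy] at hxy'
  rw [q.cosh_dist_eq_lorentz x, q.cosh_dist_eq_lorentz y, q.cosh_dist_eq_lorentz m]
  have hx := unit x
  have hy := unit y
  have hm := unit m
  generalize 1 / x.im = x1, x.re / x.im = x2, (x.re ^ 2 + x.im ^ 2) / x.im = x3 at *
  generalize 1 / y.im = y1, y.re / y.im = y2, (y.re ^ 2 + y.im ^ 2) / y.im = y3 at *
  generalize 1 / m.im = m1, m.re / m.im = m2, (m.re ^ 2 + m.im ^ 2) / m.im = m3 at *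
  generalize 1 / q.im = q1, q.re / q.im = q2, (q.re ^ 2 + q.im ^ 2) / q.im = q3 at *
  have hD : D = s + (D - s) := by ring
  generalize D - s = r at *
  subst hD
  have hs := Real.cosh_sq s
  have hr := Real.cosh_sq r
  rw [Real.cosh_add] at hxy'
  rw [Real.sinh_add]
  generalize Real.sinh s = b, Real.cosh s = B at *
  generalize Real.sinh r = a, Real.cosh r = A at *
  -- In the hyperboloid, m is the combination (sinh (D - s) x + sinh s y) / sinh D: the difference,
  -- multiplied by sinh D, is orthogonal to m and isotropic, hence zero. Pairing with q gives the
  -- claim.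
  obtain ⟨h1, h2, h3⟩ := eq_zero_of_isotropic_of_orthogonal
    (a := (b * A + B * a) * m1 - a * x1 - b * y1) (b := (b * A + B * a) * m2 - a * x2 - b * y2)
    (c := (b * A + B * a) * m3 - a * x3 - b * y3) hm
    (by linear_combination 2 * (b * A + B * a) * hm + 2 * a * hxm' + 2 * b * hmy')
    (by linear_combination (b * A + B * a) ^ 2 * hm + a ^ 2 * hx + b ^ 2 * hy +
          2 * (b * A + B * a) * a * hxm' + 2 * (b * A + B * a) * b * hmy' - 2 * a * b * hxy'
          - a ^ 2 * hs - b ^ 2 * hr)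
  linear_combination (q3 * h1 + q1 * h3) / 2 - q2 * h2

/-! ## Geodesics in CAT(-1) spaces -/

section Geodesics

variable {X : Type*} [MetricSpace X]

namespace IsGeodesicFromTo

variable {c c' : ℝ → X} {x y : X} {s : ℝ}

theorem dist_left (hc : IsGeodesicFromTo c x y) (hs : s ∈ Set.Icc 0 (dist x y)) :
    dist x (c s) = s := by
  have := hc.2.2 0 ⟨le_rfl, dist_nonneg⟩ s hs
  rwa [hc.1, zero_sub, abs_neg, abs_of_nonneg hs.1] at this

theorem dist_right (hc : IsGeodesicFromTo c x y) (hs : s ∈ Set.Icc 0 (dist x y)) :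
    dist (c s) y = dist x y - s := by
  have := hc.2.2 s hs (dist x y) ⟨dist_nonneg, le_rfl⟩
  rwa [hc.2.1, abs_sub_comm, abs_of_nonneg (sub_nonneg.2 hs.2)] at this

theorem restrict (hc : IsGeodesicFromTo c x y) (hs : s ∈ Set.Icc 0 (dist x y)) :
    IsGeodesicFromTo c x (c s) := by
  have h := hc.dist_left hs
  refine ⟨hc.1, by rw [h], fun a ha b hb => ?_⟩
  rw [h] at ha hb
  exact hc.2.2 a ⟨ha.1, ha.2.trans hs.2⟩ b ⟨hb.1, hb.2.trans hs.2⟩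

theorem reverse (hc : IsGeodesicFromTo c x y) :
    IsGeodesicFromTo (fun t => c (dist x y - t)) y x := by
  refine ⟨by simpa using hc.2.1, by simpa [dist_comm y x] using hc.1, fun a ha b hb => ?_⟩
  rw [dist_comm y x] at ha hb
  rw [hc.2.2 _ ⟨by linarith [ha.2], by linarith [ha.1]⟩ _ ⟨by linarith [hb.2], by linarith [hb.1]⟩,
    abs_sub_comm]
  ring_nf

theorem comp_isometryEquiv {Y : Type*} [MetricSpace Y] (hc : IsGeodesicFromTo c x y)
    (g : X ≃ᵢ Y) : IsGeodesicFromTo (fun t => g (c t)) (g x) (g y) := by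
  refine ⟨congrArg g hc.1, by rw [g.dist_eq]; exact congrArg g hc.2.1, fun a ha b hb => ?_⟩
  rw [g.dist_eq] at ha hb ⊢
  exact hc.2.2 a ha b hb

end IsGeodesicFromTo

namespace IsCATNegOne

/-- Stewart's inequality in a CAT(-1) space. -/
theorem sinh_mul_cosh_dist_le (hX : IsCATNegOne X) {c : ℝ → X} {x y : X}
    (hc : IsGeodesicFromTo c x y) (q : X) {s : ℝ} (hs : s ∈ Set.Icc 0 (dist x y)) :
    Real.sinh (dist x y) * Real.cosh (dist q (c s)) ≤
      Real.sinh (dist x y - s) * Real.cosh (dist q x) + Real.sinh s * Real.cosh (dist q y) := by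
  obtain ⟨c₁, hc₁⟩ := hX.exists_geodesic y q
  obtain ⟨c₂, hc₂⟩ := hX.exists_geodesic q x
  obtain ⟨x', c', hd, hg, hle⟩ := hX.comparison ![x, y, q] ![c, c₁, c₂] (by
    intro i
    fin_cases i
    · exact hc
    · exact hc₁
    · exact hc₂)
  have hd0 : dist (x' 0) (x' 1) = dist x y := hd 0
  have hd1 : dist (x' 1) (x' 2) = dist y q := hd 1
  have hd2 : dist (x' 2) (x' 0) = dist q x := hd 2
  have hg0 : IsGeodesicFromTo (c' 0) (x' 0) (x' 1) := hg 0
  have hg2 : IsGeodesicFromTo (c' 2) (x' 2) (x' 0) := hg 2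
  -- The vertex q is the initial point of the third side, so comparing points of sides also bounds
  -- the distance to q.
  have h02 : dist (c s) (c₂ 0) ≤ dist (c' 0 s) (c' 2 0) := hle 0 2 s hs 0 ⟨le_rfl, dist_nonneg⟩
  rw [hc₂.1, hg2.1] at h02
  have hs' : s ∈ Set.Icc 0 (dist (x' 0) (x' 1)) := by rwa [hd0]
  have key := UpperHalfPlane.sinh_mul_cosh_dist (hg0.dist_left hs') (hg0.dist_right hs') rfl (x' 2)
  rw [hd0, hd2, dist_comm (x' 2) (x' 1), hd1, dist_comm y q] at key
  rw [← key]
  refine mul_le_mul_of_nonneg_left ?_ (Real.sinh_nonneg_iff.2 dist_nonneg)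
  rw [Real.cosh_le_cosh, abs_of_nonneg dist_nonneg, abs_of_nonneg dist_nonneg, dist_comm q,
    dist_comm (x' 2)]
  exact h02

theorem geodesic_unique (hX : IsCATNegOne X) {c c' : ℝ → X} {x y : X}
    (hc : IsGeodesicFromTo c x y) (hc' : IsGeodesicFromTo c' x y) :
    Set.EqOn c c' (Set.Icc 0 (dist x y)) := by
  intro s hs
  rcases (dist_nonneg (x := x) (y := y)).eq_or_lt with h0 | h0
  · rw [← h0] at hs
    obtain rfl : s = 0 := le_antisymm hs.2 hs.1
    rw [hc.1, hc'.1]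
  · have h := hX.sinh_mul_cosh_dist_le hc (c' s) hs
    rw [dist_comm (c' s) x, hc'.dist_left hs, hc'.dist_right hs] at h
    -- With q = c' s the right side of Stewart's inequality is exactly sinh (dist x y), which forces
    -- cosh (dist (c' s) (c s)) ≤ 1.
    have h2 : Real.sinh (dist x y) =
        Real.sinh (dist x y - s) * Real.cosh s + Real.sinh s * Real.cosh (dist x y - s) := by
      rw [mul_comm (Real.sinh s), ← Real.sinh_add, sub_add_cancel]
    rw [← h2] at h
    have h3 : Real.cosh (dist (c' s) (c s)) ≤ Real.cosh 0 := by
      rw [Real.cosh_zero]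
      exact (mul_le_iff_le_one_right (Real.sinh_pos_iff.2 h0)).1 h
    rw [Real.cosh_le_cosh, abs_zero, abs_nonpos_iff, dist_eq_zero] at h3
    exact h3.symm

end IsCATNegOne

/-! ## Angles -/

/-- The cosine of the angle of the hyperbolic comparison triangle of `c₁ 0, c₁ s, c₂ t`, for
geodesics `c₁, c₂` issuing from the same point. -/
def hypCos (c₁ c₂ : ℝ → X) (s t : ℝ) : ℝ :=
  (Real.cosh s * Real.cosh t - Real.cosh (dist (c₁ s) (c₂ t))) / (Real.sinh s * Real.sinh t)

theorem hypCos_swap (c₁ c₂ : ℝ → X) (s t : ℝ) : hypCos c₁ c₂ s t = hypCos c₂ c₁ t s := by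
  rw [hypCos, hypCos, dist_comm, mul_comm (Real.cosh s), mul_comm (Real.sinh s)]

/-- After clearing denominators and expanding sinh (s - s'), this is Stewart's inequality for the
side from q to c₁ s and the opposite vertex c₂ t. -/
theorem IsCATNegOne.hypCos_le_left (hX : IsCATNegOne X) {c₁ c₂ : ℝ → X} {q y : X}
    (h₁ : IsGeodesicFromTo c₁ q y) {s s' t : ℝ} (hs' : 0 < s') (hss' : s' ≤ s)
    (hs : s ≤ dist q y) (ht : 0 < t) (h₂ : dist q (c₂ t) = t) :
    hypCos c₁ c₂ s t ≤ hypCos c₁ c₂ s' t := by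
  have hsI : s ∈ Set.Icc 0 (dist q y) := ⟨(hs'.trans_le hss').le, hs⟩
  have hds := h₁.dist_left hsI
  have key := hX.sinh_mul_cosh_dist_le (h₁.restrict hsI) (c₂ t) (s := s')
    ⟨hs'.le, by rwa [hds]⟩
  rw [hds, dist_comm (c₂ t) q, h₂, dist_comm, dist_comm (c₂ t), Real.sinh_sub] at key
  have p1 := Real.sinh_pos_iff.2 ht
  have p2 := Real.sinh_pos_iff.2 hs'
  have p3 := Real.sinh_pos_iff.2 (hs'.trans_le hss')
  rw [hypCos, hypCos, div_le_div_iff₀ (by positivity) (by positivity)]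
  nlinarith [mul_le_mul_of_nonneg_left key p1.le]

theorem IsCATNegOne.hypCos_antitone (hX : IsCATNegOne X) {c₁ c₂ : ℝ → X} {q y z : X}
    (h₁ : IsGeodesicFromTo c₁ q y) (h₂ : IsGeodesicFromTo c₂ q z) {s s' t t' : ℝ}
    (hs' : 0 < s') (hss' : s' ≤ s) (hs : s ≤ dist q y)
    (ht' : 0 < t') (htt' : t' ≤ t) (ht : t ≤ dist q z) :
    hypCos c₁ c₂ s t ≤ hypCos c₁ c₂ s' t' := by
  refine (hX.hypCos_le_left h₁ hs' hss' hs (ht'.trans_le htt')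
    (h₂.dist_left ⟨(ht'.trans_le htt').le, ht⟩)).trans ?_
  rw [hypCos_swap, hypCos_swap c₁]
  exact hX.hypCos_le_left h₂ ht' htt' ht hs' (h₁.dist_left ⟨hs'.le, hss'.trans hs⟩)

/-- `dslope Real.sinh 0` is sinh x / x with the value 1 at 0. It compares hyperbolic with Euclidean
quantities in the limit, even where a distance vanishes. -/
theorem Real.sinh_eq_mul_dslope (x : ℝ) : Real.sinh x = x * dslope Real.sinh 0 x := by
  have := sub_smul_dslope Real.sinh 0 x
  simpa using this.symm

theorem Real.tendsto_dslope_sinh : Tendsto (dslope Real.sinh 0) (𝓝 0) (𝓝 1) := by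
  have h : ContinuousAt (dslope Real.sinh 0) 0 :=
    continuousAt_dslope_same.2 Real.differentiable_sinh.differentiableAt
  have h2 := h.tendsto
  rwa [dslope_same, Real.deriv_sinh, Real.cosh_zero] at h2

theorem Real.cosh_sub_one (x : ℝ) : Real.cosh x - 1 = 2 * Real.sinh (x / 2) ^ 2 := by
  have h := Real.cosh_two_mul (x / 2)
  rw [Real.cosh_sq, mul_div_cancel₀ _ (two_ne_zero)] at h
  linarith

theorem hypCos_self_eq (c₁ c₂ : ℝ → X) {t : ℝ} (ht : 0 < t) :
    1 - hypCos c₁ c₂ t t =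
      2 * Real.sinh (dist (c₁ t) (c₂ t) / 2) ^ 2 / Real.sinh t ^ 2 := by
  have h := Real.sinh_pos_iff.2 ht
  rw [← Real.cosh_sub_one, hypCos]
  field_simp
  rw [Real.cosh_sq]
  ring

/-- The left side is one minus the cosine of the Euclidean comparison angle. The last factor tends
to 1 as t decreases to 0, so both comparison angles have the same limit. -/
theorem dist_sq_div_eq (c₁ c₂ : ℝ → X) {t : ℝ} (ht : 0 < t) :
    dist (c₁ t) (c₂ t) ^ 2 / (2 * t ^ 2) = (1 - hypCos c₁ c₂ t t) *
      (dslope Real.sinh 0 t / dslope Real.sinh 0 (dist (c₁ t) (c₂ t) / 2)) ^ 2 := by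
  have hpos : ∀ x, 0 < dslope Real.sinh 0 x := by
    intro x
    rcases lt_trichotomy x 0 with h | rfl | h
    · have h1 := Real.sinh_eq_mul_dslope x
      have := Real.sinh_lt_sinh.2 h
      rw [Real.sinh_zero] at this
      nlinarith
    · rw [dslope_same, Real.deriv_sinh]
      exact Real.cosh_pos 0
    · have h1 := Real.sinh_eq_mul_dslope x
      have := Real.sinh_pos_iff.2 h
      exact pos_of_mul_pos_right (h1 ▸ this) h.le
  have h1 := hpos t
  have h2 := hpos (dist (c₁ t) (c₂ t) / 2)
  rw [hypCos_self_eq c₁ c₂ ht, Real.sinh_eq_mul_dslope t,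
    Real.sinh_eq_mul_dslope (dist (c₁ t) (c₂ t) / 2)]
  field_simp

namespace IsCATNegOne

variable {c₁ c₂ c₃ : ℝ → X} {q y z w : X}

/-- A monotone bounded function has a one-sided limit. The lower bound -1 is the triangle inequality
through q. -/
theorem exists_tendsto_hypCos (hX : IsCATNegOne X)
    (h₁ : IsGeodesicFromTo c₁ q y) (h₂ : IsGeodesicFromTo c₂ q z) (hy : q ≠ y) (hz : q ≠ z) :
    ∃ C ∈ Set.Icc (-1 : ℝ) 1, Tendsto (fun t => hypCos c₁ c₂ t t) (𝓝[>] 0) (𝓝 C) := by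
  have hr : 0 < min (dist q y) (dist q z) := lt_min (dist_pos.2 hy) (dist_pos.2 hz)
  set r := min (dist q y) (dist q z) with hrdef
  have hle1 : ∀ t ∈ Set.Ioo 0 r, hypCos c₁ c₂ t t ≤ 1 := by
    intro t ht
    have := hypCos_self_eq c₁ c₂ ht.1
    have h0 : 0 ≤ 2 * Real.sinh (dist (c₁ t) (c₂ t) / 2) ^ 2 / Real.sinh t ^ 2 := by positivity
    linarith
  have hge : ∀ t ∈ Set.Ioo 0 r, -1 ≤ hypCos c₁ c₂ t t := by
    intro t ht
    have hd1 := h₁.dist_left ⟨ht.1.le, (ht.2.le.trans (min_le_left _ _))⟩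
    have hd2 := h₂.dist_left ⟨ht.1.le, (ht.2.le.trans (min_le_right _ _))⟩
    have hd : dist (c₁ t) (c₂ t) ≤ t + t := by
      have := dist_triangle_left (c₁ t) (c₂ t) q
      linarith
    have hs := Real.sinh_pos_iff.2 ht.1
    have : Real.cosh (dist (c₁ t) (c₂ t)) ≤ Real.cosh (t + t) := by
      rw [Real.cosh_le_cosh, abs_of_nonneg dist_nonneg, abs_of_nonneg (by linarith [ht.1])]
      exact hd
    rw [Real.cosh_add] at this
    rw [hypCos, le_div_iff₀ (by positivity)]
    linarith
  have hanti : AntitoneOn (fun t => hypCos c₁ c₂ t t) (Set.Ioo 0 r) := by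
    intro a ha b hb hab
    exact hX.hypCos_antitone h₁ h₂ ha.1 hab (hb.2.le.trans (min_le_left _ _)) ha.1 hab
      (hb.2.le.trans (min_le_right _ _))
  have hT := hanti.tendsto_nhdsWithin_Ioo_right (Set.nonempty_Ioo.2 hr)
    ⟨1, by rintro _ ⟨t, ht, rfl⟩; exact hle1 t ht⟩
  have hev : ∀ᶠ t in 𝓝[>] (0 : ℝ), t ∈ Set.Ioo 0 r := Ioo_mem_nhdsGT hr
  exact ⟨_, ⟨ge_of_tendsto hT (hev.mono hge), le_of_tendsto hT (hev.mono hle1)⟩, hT⟩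

theorem eventually_mem_Icc (hy : q ≠ y) : ∀ᶠ t in 𝓝[>] (0 : ℝ), t ∈ Set.Icc 0 (dist q y) := by
  filter_upwards [Ioo_mem_nhdsGT (dist_pos.2 hy)] with t ht
  exact Set.Ioo_subset_Icc_self ht

theorem tendsto_dist_zero (h₁ : IsGeodesicFromTo c₁ q y) (h₂ : IsGeodesicFromTo c₂ q z)
    (hy : q ≠ y) (hz : q ≠ z) :
    Tendsto (fun t => dist (c₁ t) (c₂ t)) (𝓝[>] 0) (𝓝 0) := by
  have h2 : Tendsto (fun t : ℝ => t + t) (𝓝[>] 0) (𝓝 0) := by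
    have : Tendsto (fun t : ℝ => t + t) (𝓝 0) (𝓝 (0 + 0)) := tendsto_id.add tendsto_id
    rw [add_zero] at this
    exact this.mono_left nhdsWithin_le_nhds
  refine tendsto_of_tendsto_of_tendsto_of_le_of_le' tendsto_const_nhds h2
    (Eventually.of_forall fun _ => dist_nonneg) ?_
  filter_upwards [eventually_mem_Icc hy, eventually_mem_Icc hz] with t h1 h2
  have := dist_triangle_left (c₁ t) (c₂ t) q
  rwa [h₁.dist_left h1, h₂.dist_left h2] at this

theorem tendsto_dist_sq_div (h₁ : IsGeodesicFromTo c₁ q y)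
    (h₂ : IsGeodesicFromTo c₂ q z) (hy : q ≠ y) (hz : q ≠ z) {C : ℝ}
    (hC : Tendsto (fun t => hypCos c₁ c₂ t t) (𝓝[>] 0) (𝓝 C)) :
    Tendsto (fun t => dist (c₁ t) (c₂ t) ^ 2 / (2 * t ^ 2)) (𝓝[>] 0) (𝓝 (1 - C)) := by
  have hd : Tendsto (fun t => dist (c₁ t) (c₂ t) / 2) (𝓝[>] 0) (𝓝 0) := by
    simpa using (tendsto_dist_zero h₁ h₂ hy hz).div_const 2
  have hlim := (hC.const_sub 1).mul
    (((Real.tendsto_dslope_sinh.mono_left (nhdsWithin_le_nhds (s := Set.Ioi 0))).div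
      (Real.tendsto_dslope_sinh.comp hd) one_ne_zero).pow 2)
  rw [div_one, one_pow, mul_one] at hlim
  refine hlim.congr' ?_
  filter_upwards [self_mem_nhdsWithin] with t ht
  exact (dist_sq_div_eq c₁ c₂ ht).symm

theorem geodesicAngle_eq_arccos (h₁ : IsGeodesicFromTo c₁ q y)
    (h₂ : IsGeodesicFromTo c₂ q z) (hy : q ≠ y) (hz : q ≠ z) {C : ℝ}
    (hC : Tendsto (fun t => hypCos c₁ c₂ t t) (𝓝[>] 0) (𝓝 C)) :
    geodesicAngle c₁ c₂ = Real.arccos C := by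
  refine Tendsto.limsup_eq ?_
  have h := Real.continuous_arccos.continuousAt.tendsto.comp
    ((tendsto_dist_sq_div h₁ h₂ hy hz hC).const_sub 1)
  rw [sub_sub_cancel] at h
  refine h.congr' ?_
  filter_upwards [eventually_mem_Icc hy, eventually_mem_Icc hz, self_mem_nhdsWithin] with t h1 h2 ht
  have ht : 0 < t := ht
  rw [Function.comp_apply, comparisonAngle, h₁.1, h₁.dist_left h1, h₂.dist_left h2]
  congr 1
  field_simp
  ring

theorem geodesicAngle_congr {c₁' c₂' : ℝ → X} (hX : IsCATNegOne X)
    (h₁ : IsGeodesicFromTo c₁ q y) (h₂ : IsGeodesicFromTo c₂ q z)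
    (h₁' : IsGeodesicFromTo c₁' q y) (h₂' : IsGeodesicFromTo c₂' q z)
    (hy : q ≠ y) (hz : q ≠ z) : geodesicAngle c₁ c₂ = geodesicAngle c₁' c₂' := by
  refine limsup_congr ?_
  filter_upwards [eventually_mem_Icc hy, eventually_mem_Icc hz] with t h1 h2
  rw [hX.geodesic_unique h₁ h₁' h1, hX.geodesic_unique h₂ h₂' h2, h₁.1, h₁'.1]

theorem isGeodesicFromTo_geodesicSegment (hX : IsCATNegOne X) (x y : X) :
    IsGeodesicFromTo (geodesicSegment x y) x y := by
  rw [geodesicSegment, dif_pos (hX.exists_geodesic x y)]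
  exact (hX.exists_geodesic x y).choose_spec

theorem tendsto_hypCos (hX : IsCATNegOne X) (h₁ : IsGeodesicFromTo c₁ q y)
    (h₂ : IsGeodesicFromTo c₂ q z) (hy : q ≠ y) (hz : q ≠ z) :
    Tendsto (fun t => hypCos c₁ c₂ t t) (𝓝[>] 0) (𝓝 (Real.cos (alexandrovAngle q y z))) := by
  obtain ⟨C, hC, hT⟩ := hX.exists_tendsto_hypCos h₁ h₂ hy hz
  rw [alexandrovAngle, hX.geodesicAngle_congr (hX.isGeodesicFromTo_geodesicSegment q y)
    (hX.isGeodesicFromTo_geodesicSegment q z) h₁ h₂ hy hz,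
    geodesicAngle_eq_arccos h₁ h₂ hy hz hT, Real.cos_arccos hC.1 hC.2]
  exact hT

theorem alexandrovAngle_mem (hX : IsCATNegOne X) (hy : q ≠ y) (hz : q ≠ z) :
    alexandrovAngle q y z ∈ Set.Icc 0 Real.pi := by
  have h₁ := hX.isGeodesicFromTo_geodesicSegment q y
  have h₂ := hX.isGeodesicFromTo_geodesicSegment q z
  obtain ⟨C, hC, hT⟩ := hX.exists_tendsto_hypCos h₁ h₂ hy hz
  rw [alexandrovAngle, geodesicAngle_eq_arccos h₁ h₂ hy hz hT]
  exact ⟨Real.arccos_nonneg _, Real.arccos_le_pi _⟩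

/-- Monotonicity in each variable turns a bound at one diagonal point (r, r) into one for all s, t ≤
r. This permits different speeds along the two geodesics. -/
theorem cosh_dist_le (hX : IsCATNegOne X) (h₁ : IsGeodesicFromTo c₁ q y)
    (h₂ : IsGeodesicFromTo c₂ q z) (hy : q ≠ y) (hz : q ≠ z) {M : ℝ}
    (hM : M < Real.cos (alexandrovAngle q y z)) :
    ∃ r, 0 < r ∧ ∀ s t, 0 < s → s ≤ r → 0 < t → t ≤ r →
      Real.cosh (dist (c₁ s) (c₂ t)) ≤
        Real.cosh s * Real.cosh t - Real.sinh s * Real.sinh t * M := by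
  have h := ((hX.tendsto_hypCos h₁ h₂ hy hz).eventually_const_le hM).and
    (((eventually_mem_Icc hy).and (eventually_mem_Icc hz)).and self_mem_nhdsWithin)
  obtain ⟨r, hr, ⟨hr1, hr2⟩, hr0⟩ := h.exists
  refine ⟨r, hr0, fun s t hs hsr ht htr => ?_⟩
  have h1 := hr.trans (hX.hypCos_antitone h₁ h₂ hs hsr hr1.2 ht htr hr2.2)
  have p1 := Real.sinh_pos_iff.2 hs
  have p2 := Real.sinh_pos_iff.2 ht
  rw [hypCos, le_div_iff₀ (by positivity)] at h1
  linarith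

end IsCATNegOne

end Geodesics

/-! ### Triangle inequality for angles and first variation of distance -/

section Angles

variable {X : Type*} [MetricSpace X]

theorem alexandrovAngle_comm (q y z : X) : alexandrovAngle q y z = alexandrovAngle q z y := by
  classical
  rw [alexandrovAngle, alexandrovAngle, geodesicAngle, geodesicAngle]
  congr 1
  funext t
  have h : geodesicSegment q y 0 = geodesicSegment q z 0 := by
    have hq : ∀ w, geodesicSegment q w 0 = q := by
      intro w
      rw [geodesicSegment]
      split_ifs with h
      exacts [h.choose_spec.1, rfl]
    rw [hq, hq]
  rw [comparisonAngle, comparisonAngle, h, dist_comm (geodesicSegment q y t)]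
  congr 1
  ring

theorem Real.tendsto_cosh_mul_sub_one_div (a : ℝ) :
    Tendsto (fun t => (Real.cosh (a * t) - 1) / t ^ 2) (𝓝[>] 0) (𝓝 (a ^ 2 / 2)) := by
  have h0 : Tendsto (fun t : ℝ => a * t / 2) (𝓝[>] 0) (𝓝 0) := by
    have : Tendsto (fun t : ℝ => a * t / 2) (𝓝 0) (𝓝 (a * 0 / 2)) :=
      (continuous_const.mul continuous_id |>.div_const 2).tendsto 0
    rw [mul_zero, zero_div] at this
    exact this.mono_left nhdsWithin_le_nhds
  have h := ((Real.tendsto_dslope_sinh.comp h0).pow 2).const_mul (a ^ 2 / 2)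
  rw [one_pow, mul_one] at h
  refine h.congr' ?_
  filter_upwards [self_mem_nhdsWithin] with t ht
  have ht : 0 < t := ht
  rw [Real.cosh_sub_one, Real.sinh_eq_mul_dslope (a * t / 2), Function.comp_apply]
  field_simp

namespace IsCATNegOne

variable {c₁ c₂ c₃ : ℝ → X} {q y z w : X}

theorem alexandrovAngle_self (hX : IsCATNegOne X) (hy : q ≠ y) : alexandrovAngle q y y = 0 := by
  have h₁ := hX.isGeodesicFromTo_geodesicSegment q y
  have hT := hX.tendsto_hypCos h₁ h₁ hy hy
  have h1 : Tendsto (fun t => hypCos (geodesicSegment q y) (geodesicSegment q y) t t)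
      (𝓝[>] 0) (𝓝 1) := by
    refine tendsto_const_nhds.congr' ?_
    filter_upwards [self_mem_nhdsWithin] with t ht
    have := hypCos_self_eq (geodesicSegment q y) (geodesicSegment q y) (Set.mem_Ioi.1 ht)
    rw [dist_self, zero_div, Real.sinh_zero] at this
    norm_num at this
    linarith
  have hm := hX.alexandrovAngle_mem hy hy
  have h2 := tendsto_nhds_unique hT h1
  rw [← Real.arccos_cos hm.1 hm.2, h2, Real.arccos_one]

/-- An upper bound for the growth of the distance of two points moving on geodesics issuing from
the same point: the Euclidean law of cosines. -/
theorem eventually_dist_le_mul (hX : IsCATNegOne X) (h₁ : IsGeodesicFromTo c₁ q y)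
    (h₂ : IsGeodesicFromTo c₂ q z) (hy : q ≠ y) (hz : q ≠ z) {a b K : ℝ} (ha : 0 < a) (hb : 0 < b)
    (hK : 0 ≤ K) (h : a ^ 2 + b ^ 2 - 2 * a * b * Real.cos (alexandrovAngle q y z) < K ^ 2) :
    ∀ᶠ t in 𝓝[>] (0 : ℝ), dist (c₁ (a * t)) (c₂ (b * t)) ≤ K * t := by
  obtain ⟨M, hM1, hM2⟩ : ∃ M, (a ^ 2 + b ^ 2 - K ^ 2) / (2 * a * b) < M ∧
      M < Real.cos (alexandrovAngle q y z) := by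
    refine exists_between ?_
    rw [div_lt_iff₀ (by positivity)]
    linarith
  rw [div_lt_iff₀ (by positivity)] at hM1
  obtain ⟨r, hr, hle⟩ := hX.cosh_dist_le h₁ h₂ hy hz hM2
  -- Uses cosh u cosh v - M sinh u sinh v = (1 - M)/2 · cosh (u + v) + (1 + M)/2 · cosh (u - v) with
  -- u = a t and v = b t.
  have hsum := ((Real.tendsto_cosh_mul_sub_one_div (a + b)).const_mul ((1 - M) / 2)).add
    ((Real.tendsto_cosh_mul_sub_one_div (a - b)).const_mul ((1 + M) / 2))
  have hlt : (1 - M) / 2 * ((a + b) ^ 2 / 2) + (1 + M) / 2 * ((a - b) ^ 2 / 2) < K ^ 2 / 2 := by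
    linarith
  have hsmall : ∀ k : ℝ, 0 < k → ∀ᶠ t in 𝓝[>] (0 : ℝ), k * t ≤ r := by
    intro k hk
    filter_upwards [Ioo_mem_nhdsGT (div_pos hr hk)] with t ht
    have := (lt_div_iff₀ hk).1 ht.2
    linarith
  filter_upwards [hsum.eventually_lt_const hlt, hsmall a ha, hsmall b hb, self_mem_nhdsWithin]
    with t h1 h2 h3 ht
  have ht : 0 < t := ht
  have h4 := hle (a * t) (b * t) (by positivity) h2 (by positivity) h3
  have e1 := Real.cosh_add (a * t) (b * t)
  have e2 := Real.cosh_sub (a * t) (b * t)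
  rw [← add_mul] at e1
  rw [← sub_mul] at e2
  rw [mul_div_assoc', mul_div_assoc', ← add_div, div_lt_iff₀ (by positivity)] at h1
  have h5 : Real.cosh (dist (c₁ (a * t)) (c₂ (b * t))) - 1 ≤ (K * t) ^ 2 / 2 := by
    rw [e1, e2] at h1
    nlinarith
  rw [Real.cosh_sub_one] at h5
  have h6 := Real.self_le_sinh_iff.2
    (div_nonneg (dist_nonneg (x := c₁ (a * t)) (y := c₂ (b * t))) zero_le_two)
  have h7 : (0 : ℝ) ≤ dist (c₁ (a * t)) (c₂ (b * t)) := dist_nonneg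
  have h8 : 0 ≤ K * t := by positivity
  refine le_of_sq_le_sq ?_ h8
  nlinarith

/-- Let α, β slightly exceed the two angles on the right, with α + β still below the third. In the
plane take the isosceles triangle with apex angle α + β = 2σ and legs cos δ, where δ = (α - β)/2.
The ray at angle α meets the base at distance cos σ from the apex and cuts it into pieces sin α and
sin β. Points moving along the three geodesics at speeds cos δ, cos σ, cos δ are asymptotically no
farther apart than these pieces, so the angle between the outer geodesics is at most α + β, a
contradiction. -/
theorem alexandrovAngle_triangle (hX : IsCATNegOne X) (hy : q ≠ y) (hz : q ≠ z) (hw : q ≠ w) :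
    alexandrovAngle q y w ≤ alexandrovAngle q y z + alexandrovAngle q z w := by
  by_contra! hlt
  have m1 := hX.alexandrovAngle_mem hy hz
  have m2 := hX.alexandrovAngle_mem hz hw
  have m3 := hX.alexandrovAngle_mem hy hw
  have h₁ := hX.isGeodesicFromTo_geodesicSegment q y
  have h₂ := hX.isGeodesicFromTo_geodesicSegment q z
  have h₃ := hX.isGeodesicFromTo_geodesicSegment q w
  obtain ⟨η, hη, hη2⟩ : ∃ η, 0 < η ∧
      alexandrovAngle q y z + η + (alexandrovAngle q z w + η) < alexandrovAngle q y w :=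
    ⟨(alexandrovAngle q y w - (alexandrovAngle q y z + alexandrovAngle q z w)) / 3,
      by linarith, by linarith⟩
  obtain ⟨α, hα⟩ : ∃ α, α = alexandrovAngle q y z + η := ⟨_, rfl⟩
  obtain ⟨β, hβ⟩ : ∃ β, β = alexandrovAngle q z w + η := ⟨_, rfl⟩
  rw [← hα, ← hβ] at hη2
  have hα0 : 0 < α := by linarith [m1.1]
  have hβ0 : 0 < β := by linarith [m2.1]
  have hsum : α + β < Real.pi := hη2.trans_le m3.2
  have hcα : Real.cos α < Real.cos (alexandrovAngle q y z) :=
    Real.cos_lt_cos_of_nonneg_of_le_pi m1.1 (by linarith) (by linarith)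
  have hcβ : Real.cos β < Real.cos (alexandrovAngle q z w) :=
    Real.cos_lt_cos_of_nonneg_of_le_pi m2.1 (by linarith) (by linarith)
  obtain ⟨σ, hσ⟩ : ∃ σ, σ = (α + β) / 2 := ⟨_, rfl⟩
  obtain ⟨δ, hδ⟩ : ∃ δ, δ = (α - β) / 2 := ⟨_, rfl⟩
  have hασ : α = σ + δ := by linarith
  have hβσ : β = σ - δ := by linarith
  have ha : 0 < Real.cos δ := Real.cos_pos_of_mem_Ioo ⟨by linarith, by linarith⟩
  have hb : 0 < Real.cos σ := Real.cos_pos_of_mem_Ioo ⟨by linarith, by linarith⟩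
  have hsα : 0 < Real.sin α := Real.sin_pos_of_pos_of_lt_pi hα0 (by linarith)
  have hsβ : 0 < Real.sin β := Real.sin_pos_of_pos_of_lt_pi hβ0 (by linarith)
  have hsσ : 0 < Real.sin σ := Real.sin_pos_of_pos_of_lt_pi (by linarith) (by linarith)
  have idα : Real.cos δ ^ 2 + Real.cos σ ^ 2 - 2 * Real.cos δ * Real.cos σ * Real.cos α =
      Real.sin α ^ 2 := by
    rw [hασ, Real.cos_add, Real.sin_add]
    linear_combination (-Real.cos δ ^ 2) * Real.sin_sq_add_cos_sq σ -
      Real.cos σ ^ 2 * Real.sin_sq_add_cos_sq δ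
  have idβ : Real.cos σ ^ 2 + Real.cos δ ^ 2 - 2 * Real.cos σ * Real.cos δ * Real.cos β =
      Real.sin β ^ 2 := by
    rw [hβσ, Real.cos_sub, Real.sin_sub]
    linear_combination (-Real.cos δ ^ 2) * Real.sin_sq_add_cos_sq σ -
      Real.cos σ ^ 2 * Real.sin_sq_add_cos_sq δ
  have hab : 0 < Real.cos δ * Real.cos σ := mul_pos ha hb
  have e1 := hX.eventually_dist_le_mul h₁ h₂ hy hz ha hb hsα.le (by nlinarith)
  have e2 := hX.eventually_dist_le_mul h₂ h₃ hz hw hb ha hsβ.le (by nlinarith)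
  have hs : Real.sin α + Real.sin β = 2 * Real.sin σ * Real.cos δ := by
    rw [hασ, hβσ, Real.sin_add, Real.sin_sub]
    ring
  have hT := tendsto_dist_sq_div h₁ h₃ hy hw (hX.tendsto_hypCos h₁ h₃ hy hw)
  have hmul : Tendsto (fun t : ℝ => Real.cos δ * t) (𝓝[>] 0) (𝓝[>] 0) := by
    refine tendsto_nhdsWithin_iff.2 ⟨?_, ?_⟩
    · have : Tendsto (fun t : ℝ => Real.cos δ * t) (𝓝 0) (𝓝 (Real.cos δ * 0)) :=
        (continuous_const.mul continuous_id).tendsto 0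
      rw [mul_zero] at this
      exact this.mono_left nhdsWithin_le_nhds
    · filter_upwards [self_mem_nhdsWithin] with t ht
      exact mul_pos ha ht
  have hle : 1 - Real.cos (alexandrovAngle q y w) ≤ 2 * Real.sin σ ^ 2 := by
    refine le_of_tendsto (hT.comp hmul) ?_
    filter_upwards [e1, e2, self_mem_nhdsWithin] with t h1 h2 ht
    have ht : 0 < t := ht
    have h3 : dist (geodesicSegment q y (Real.cos δ * t)) (geodesicSegment q w (Real.cos δ * t)) ≤
        2 * Real.sin σ * Real.cos δ * t := by
      rw [← hs, add_mul]
      exact (dist_triangle _ _ _).trans (add_le_add h1 h2)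
    rw [Function.comp_apply, div_le_iff₀ (by positivity)]
    have h4 := pow_le_pow_left₀ dist_nonneg h3 2
    linarith [h4]
  have hcos : Real.cos (α + β) = 1 - 2 * Real.sin σ ^ 2 := by
    rw [show α + β = 2 * σ by linarith, Real.cos_two_mul]
    linear_combination 2 * Real.sin_sq_add_cos_sq σ
  have hcontra := Real.cos_lt_cos_of_nonneg_of_le_pi (x := α + β) (by linarith) m3.2 hη2
  linarith

/-- First variation inequality. -/
theorem eventually_dist_le_sub (hX : IsCATNegOne X) (h₁ : IsGeodesicFromTo c₁ q y)
    (h₂ : IsGeodesicFromTo c₂ q z) (hy : q ≠ y) (hz : q ≠ z) {M : ℝ}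
    (hM : M < Real.cos (alexandrovAngle q y z)) :
    ∀ᶠ s in 𝓝[>] (0 : ℝ), ∀ᶠ t in 𝓝[>] (0 : ℝ), dist (c₁ t) (c₂ s) ≤ s - t * M := by
  obtain ⟨N, hMN, hN⟩ := exists_between hM
  obtain ⟨r, hr, hle⟩ := hX.cosh_dist_le h₁ h₂ hy hz hN
  filter_upwards [Ioo_mem_nhdsGT hr] with s hs
  have hsinh := Real.sinh_pos_iff.2 hs.1
  -- For fixed s, the desired bound minus the available one vanishes at t = 0 and has positive
  -- derivative there, so it is positive for small t > 0.
  have hd : HasDerivAt (fun t => Real.cosh (s - t * M) -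
      (Real.cosh t * Real.cosh s - Real.sinh t * Real.sinh s * N))
      (Real.sinh s * (N - M)) 0 := by
    have h1 : HasDerivAt (fun t : ℝ => s - t * M) (-M) 0 := by
      simpa using ((hasDerivAt_id (0 : ℝ)).mul_const M).const_sub s
    have h2 := h1.cosh
    have h3 := ((Real.hasDerivAt_cosh 0).mul_const (Real.cosh s)).sub
      (((Real.hasDerivAt_sinh 0).mul_const (Real.sinh s)).mul_const N)
    refine (h2.sub h3).congr_deriv ?_
    simp
    ring
  have hslope := (hasDerivAt_iff_tendsto_slope.1 hd).mono_left
    (nhdsWithin_mono 0 (fun t (ht : 0 < t) => ht.ne'))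
  have hpos : 0 < Real.sinh s * (N - M) := mul_pos hsinh (sub_pos.2 hMN)
  have hnn : ∀ᶠ t in 𝓝[>] (0 : ℝ), 0 < s - t * M := by
    have : Tendsto (fun t : ℝ => s - t * M) (𝓝 0) (𝓝 (s - 0 * M)) :=
      (continuous_const.sub (continuous_id.mul continuous_const)).tendsto 0
    rw [zero_mul, sub_zero] at this
    exact (this.mono_left nhdsWithin_le_nhds).eventually_const_lt hs.1
  filter_upwards [hslope.eventually_const_lt hpos, hnn, Ioo_mem_nhdsGT hr] with t ht1 ht2 ht
  rw [slope_def_field] at ht1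
  simp only [zero_mul, sub_zero, Real.cosh_zero, Real.sinh_zero, one_mul, sub_self] at ht1
  have h4 := hle t s ht.1 ht.2.le hs.1 hs.2.le
  have h5 := (div_pos_iff_of_pos_right ht.1).1 ht1
  have h6 : Real.cosh (dist (c₁ t) (c₂ s)) ≤ Real.cosh (s - t * M) := by linarith
  rwa [Real.cosh_le_cosh, abs_of_nonneg dist_nonneg, abs_of_pos ht2] at h6

end IsCATNegOne

end Angles

/-! ## Balanced closed polygons of directions -/

theorem Real.cos_le_cos_of_le_circleDist {a d L : ℝ} (ha : 0 ≤ a) (hd : a ≤ d) (hdL : a ≤ L - d)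
    (hL : L ≤ 2 * Real.pi) : Real.cos d ≤ Real.cos a := by
  rcases le_total d Real.pi with h | h
  · exact Real.cos_le_cos_of_nonneg_of_le_pi ha h hd
  · rw [← Real.cos_two_pi_sub d]
    exact Real.cos_le_cos_of_nonneg_of_le_pi ha (by linarith) (by linarith)

/-- On a circle of length `L < 2 * π`, no positive weights are balanced. -/
theorem pos_sum_mul_cos_of_circle {ι : Type*} [Fintype ι] {t ℓ : ι → ℝ} {A : ι → ι → ℝ} {L : ℝ}
    (hL : L < 2 * Real.pi) (hA0 : ∀ i j, 0 ≤ A i j) (hA : ∀ i j, A i j ≤ |t i - t j|)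
    (hAL : ∀ i j, A i j ≤ L - |t i - t j|) (hℓ : ∀ i, 0 < ℓ i) (i₀ : ι) (ht : ∀ i, t i₀ ≤ t i) :
    0 < ∑ i, ∑ j, ℓ i * ℓ j * Real.cos (A i j) := by
  have hcos : ∀ i j, Real.cos (t i - t j) ≤ Real.cos (A i j) := fun i j => by
    rw [← Real.cos_abs]
    exact Real.cos_le_cos_of_le_circleDist (hA0 i j) (hA i j) (hAL i j) hL.le
  have hterm : ∀ i j, ℓ i * ℓ j * Real.cos (t i - t j) ≤ ℓ i * ℓ j * Real.cos (A i j) :=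
    fun i j => mul_le_mul_of_nonneg_left (hcos i j) (mul_pos (hℓ i) (hℓ j)).le
  -- The squared length of the planar vector ∑ ℓᵢ exp(i tᵢ).
  have hsq : ∑ i, ∑ j, ℓ i * ℓ j * Real.cos (t i - t j) =
      (∑ i, ℓ i * Real.cos (t i)) ^ 2 + (∑ i, ℓ i * Real.sin (t i)) ^ 2 := by
    rw [pow_two, pow_two, Finset.sum_mul_sum, Finset.sum_mul_sum, ← Finset.sum_add_distrib]
    refine Finset.sum_congr rfl fun i _ => ?_
    rw [← Finset.sum_add_distrib]
    refine Finset.sum_congr rfl fun j _ => ?_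
    rw [Real.cos_sub]
    ring
  by_contra! hle
  have hle' : ∑ i, ∑ j, ℓ i * ℓ j * Real.cos (t i - t j) ≤
      ∑ i, ∑ j, ℓ i * ℓ j * Real.cos (A i j) :=
    Finset.sum_le_sum fun i _ => Finset.sum_le_sum fun j _ => hterm i j
  have hc0 : ∑ i, ℓ i * Real.cos (t i) = 0 := by
    nlinarith [sq_nonneg (∑ i, ℓ i * Real.cos (t i)), sq_nonneg (∑ i, ℓ i * Real.sin (t i))]
  have hs0 : ∑ i, ℓ i * Real.sin (t i) = 0 := by
    nlinarith [sq_nonneg (∑ i, ℓ i * Real.cos (t i)), sq_nonneg (∑ i, ℓ i * Real.sin (t i))]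
  have heq : ∀ i j, Real.cos (A i j) ≤ Real.cos (t i - t j) := by
    intro i j
    by_contra! hlt
    refine absurd hle (not_le.2 ?_)
    calc 0 ≤ ∑ i, ∑ j, ℓ i * ℓ j * Real.cos (t i - t j) := by rw [hsq]; positivity
      _ < _ := Finset.sum_lt_sum (fun i _ => Finset.sum_le_sum fun j _ => hterm i j)
        ⟨i, Finset.mem_univ i, Finset.sum_lt_sum (fun j _ => hterm i j)
          ⟨j, Finset.mem_univ j, mul_lt_mul_of_pos_left hlt (mul_pos (hℓ i) (hℓ j))⟩⟩
  have hL0 : 0 ≤ L := by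
    have := hAL i₀ i₀
    rw [sub_self, abs_zero, sub_zero] at this
    exact (hA0 i₀ i₀).trans this
  -- If the arc d from t i₀ exceeded L / 2, the complementary arc L - d would be less than both d
  -- and 2π - d, making the cosine inequality strict.
  have hhalf : ∀ i, t i - t i₀ ≤ L / 2 := by
    intro i
    by_contra! hlt
    have h1 := heq i i₀
    have h2 := hAL i i₀
    rw [abs_of_nonneg (sub_nonneg.2 (ht i))] at h2
    refine absurd h1 (not_le.2 ?_)
    rcases le_total (t i - t i₀) Real.pi with h | h
    · exact Real.cos_lt_cos_of_nonneg_of_le_pi (hA0 _ _) h (by linarith)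
    · rw [← Real.cos_two_pi_sub (t i - t i₀)]
      exact Real.cos_lt_cos_of_nonneg_of_le_pi (hA0 _ _) (by linarith) (by linarith)
  -- All points lie within L / 4 < π / 2 of the midpoint t i₀ + L / 4, so the vector sum has a
  -- positive component in that direction.
  have hpos : 0 < ∑ i, ℓ i * Real.cos (t i - (t i₀ + L / 4)) := by
    refine Finset.sum_pos (fun i _ => mul_pos (hℓ i) (Real.cos_pos_of_mem_Ioo ⟨?_, ?_⟩))
      ⟨i₀, Finset.mem_univ _⟩
    · linarith [ht i]
    · linarith [hhalf i]
  have hzero : ∑ i, ℓ i * Real.cos (t i - (t i₀ + L / 4)) =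
      (∑ i, ℓ i * Real.cos (t i)) * Real.cos (t i₀ + L / 4) +
        (∑ i, ℓ i * Real.sin (t i)) * Real.sin (t i₀ + L / 4) := by
    rw [Finset.sum_mul, Finset.sum_mul, ← Finset.sum_add_distrib]
    refine Finset.sum_congr rfl fun i _ => ?_
    rw [Real.cos_sub]
    ring
  rw [hzero, hc0, hs0, zero_mul, zero_mul, add_zero] at hpos
  exact lt_irrefl _ hpos

/-- A balanced closed polygon of directions has length at least `2 * π`. -/
theorem two_pi_le_sum_of_balanced {K : Type*} [Fintype K] [Nonempty K] (σ : Equiv.Perm K)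
    (hσ : ∀ a b, σ.SameCycle a b) (A : K → K → ℝ) (hA0 : ∀ a b, 0 ≤ A a b)
    (hself : ∀ a, A a a = 0) (hcomm : ∀ a b, A a b = A b a)
    (htri : ∀ a b c, A a c ≤ A a b + A b c) {ℓ : K → ℝ} (hℓ : ∀ k, 0 < ℓ k)
    (hbal : ∀ b, ∑ a, ℓ a * Real.cos (A b a) ≤ 0) : 2 * Real.pi ≤ ∑ k, A k (σ k) := by
  classical
  by_contra! hlt
  obtain ⟨a₀⟩ := ‹Nonempty K›
  have hcyc : σ.IsCycleOn ((Finset.univ : Finset K) : Set K) :=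
    ⟨by rw [Finset.coe_univ]; exact Set.bijOn_univ.2 σ.bijective, fun a _ b _ => hσ a b⟩
  set n := (Finset.univ : Finset K).card with hn
  set κ : ℕ → K := fun i => (σ ^ i) a₀ with hκ
  have hκs : ∀ i, κ (i + 1) = σ (κ i) := fun i => by
    simp only [hκ, pow_succ', Equiv.Perm.mul_apply]
  have hκn : κ n = κ 0 := hcyc.pow_card_apply (Finset.mem_univ a₀)
  have hsurj : Function.Surjective (fun i : Fin n => κ i) := fun b => by
    obtain ⟨i, hi, rfl⟩ := hcyc.exists_pow_eq (Finset.mem_univ a₀) (Finset.mem_univ b)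
    exact ⟨⟨i, hi⟩, rfl⟩
  have hbij : Function.Bijective (fun i : Fin n => κ i) :=
    (Fintype.bijective_iff_surjective_and_card _).2 ⟨hsurj, by rw [Fintype.card_fin]; rfl⟩
  -- Position along the unrolled polygon; the point κ n = κ 0 closes it at t n = L.
  set t : ℕ → ℝ := fun i => ∑ k ∈ Finset.range i, A (κ k) (κ (k + 1)) with htdef
  have hts : ∀ i, t (i + 1) = t i + A (κ i) (κ (i + 1)) := fun i => Finset.sum_range_succ _ _
  have hmono : Monotone t := monotone_nat_of_le_succ fun i => by
    rw [hts]
    linarith [hA0 (κ i) (κ (i + 1))]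
  have hAt : ∀ i j, i ≤ j → A (κ i) (κ j) ≤ t j - t i := by
    intro i j hij
    induction j, hij using Nat.le_induction with
    | base => rw [hself, sub_self]
    | succ j _ ih =>
      rw [hts]
      linarith [htri (κ i) (κ j) (κ (j + 1))]
  have hL : t n = ∑ k, A k (σ k) := by
    rw [← hbij.sum_comp]
    simp only [htdef, ← hκs]
    rw [← Fin.sum_univ_eq_sum_range (fun k => A (κ k) (κ (k + 1)))]
  have ht0 : t 0 = 0 := Finset.sum_range_zero _
  -- The complementary arc runs from κ j to κ n = κ 0 and on to κ i.
  have hAL : ∀ i j, i ≤ j → j ≤ n → A (κ i) (κ j) ≤ t n - (t j - t i) := by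
    intro i j hij hjn
    have h1 := hAt j n hjn
    have h2 := hAt 0 i i.zero_le
    have h3 := htri (κ j) (κ n) (κ i)
    rw [hκn] at h1 h3
    rw [hcomm]
    linarith
  have hnpos : 0 < n := Finset.card_pos.2 ⟨a₀, Finset.mem_univ _⟩
  have key := pos_sum_mul_cos_of_circle (ι := Fin n) (t := fun i => t i) (ℓ := fun i => ℓ (κ i))
    (A := fun i j => A (κ i) (κ j)) (L := t n) (hL ▸ hlt) (fun _ _ => hA0 _ _)
    (fun i j => by
      rcases le_total (i : ℕ) j with h | h
      · rw [abs_sub_comm, abs_of_nonneg (sub_nonneg.2 (hmono h))]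
        exact hAt _ _ h
      · rw [abs_of_nonneg (sub_nonneg.2 (hmono h)), hcomm]
        exact hAt _ _ h)
    (fun i j => by
      rcases le_total (i : ℕ) j with h | h
      · rw [abs_sub_comm, abs_of_nonneg (sub_nonneg.2 (hmono h))]
        exact hAL _ _ h j.2.le
      · rw [abs_of_nonneg (sub_nonneg.2 (hmono h)), hcomm]
        exact hAL _ _ h i.2.le)
    (fun _ => hℓ _) ⟨0, hnpos⟩ (fun i => hmono (Nat.zero_le _))
  refine absurd key (not_lt.2 ?_)
  refine Finset.sum_nonpos fun i _ => ?_
  have h := hbal (κ i)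
  rw [← hbij.sum_comp] at h
  simp only [mul_assoc]
  rw [← Finset.mul_sum]
  exact mul_nonpos_of_nonneg_of_nonpos (hℓ _).le h

/-! ## Lifts to the universal cover -/

instance : ContractibleSpace StdTriangle :=
  (convex_stdSimplex ℝ (Fin 3)).contractibleSpace ⟨_, single_mem_stdSimplex ℝ 0⟩

instance : LocallyPathConnectedSpace StdTriangle :=
  (convex_stdSimplex ℝ (Fin 3)).locallyPathConnectedSpace

theorem IsLocalHomeomorph.locallyPathConnectedSpace {Y Z : Type*} [TopologicalSpace Y]
    [TopologicalSpace Z] [LocallyPathConnectedSpace Z] {f : Y → Z} (hf : IsLocalHomeomorph f) :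
    LocallyPathConnectedSpace Y := by
  choose e he _ using hf
  let _ : ChartedSpace Z Y :=
    { atlas := Set.range e
      chartAt := e
      mem_chart_source := he
      chart_mem_atlas := fun y => ⟨y, rfl⟩ }
  exact ChartedSpace.locallyPathConnectedSpace Z Y

section Deck

variable {S S' : Type*} [TopologicalSpace S] [TopologicalSpace S'] {p : S' → S}

/-- Lift p through itself with z ↦ z', and again with z' ↦ z; by uniqueness of lifts the two maps
are mutually inverse. -/
theorem IsCoveringMap.exists_deckGroup_apply_eq [SimplyConnectedSpace S']
    [LocallyPathConnectedSpace S'] (hp : IsCoveringMap p) {z z' : S'} (h : p z = p z') :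
    ∃ g : DeckGroup p, g.1 z = z' := by
  obtain ⟨a, ⟨ha, hpa⟩, -⟩ := hp.existsUnique_continuousMap_lifts ⟨p, hp.continuous⟩ z z' h.symm
  obtain ⟨b, ⟨hb, hpb⟩, -⟩ := hp.existsUnique_continuousMap_lifts ⟨p, hp.continuous⟩ z' z h
  have hpa' : ∀ w, p (a w) = p w := congrFun hpa
  have hpb' : ∀ w, p (b w) = p w := congrFun hpb
  have hba : b ∘ a = id := hp.eq_of_comp_eq (b.continuous.comp a.continuous) continuous_id
    (funext fun w => by simp [hpb', hpa']) z (by simp [ha, hb])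
  have hab : a ∘ b = id := hp.eq_of_comp_eq (a.continuous.comp b.continuous) continuous_id
    (funext fun w => by simp [hpb', hpa']) z' (by simp [ha, hb])
  exact ⟨⟨⟨⟨a, b, congrFun hba, congrFun hab⟩, a.continuous, b.continuous⟩, hpa'⟩, ha⟩

theorem IsCoveringMap.deckGroup_ext [PreconnectedSpace S'] (hp : IsCoveringMap p)
    {g h : DeckGroup p} {z : S'} (hz : g.1 z = h.1 z) : g = h :=
  Subtype.ext (Homeomorph.ext (congrFun (hp.eq_of_comp_eq g.1.continuous h.1.continuous
    (funext fun w => (g.2 w).trans (h.2 w).symm) z hz)))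

end Deck

/-! ## Vertices and sides of the standard triangle -/

theorem sidePoint_zero (i : Fin 3) : sidePoint i 0 = triangleVertex i := by
  ext j
  simp [sidePoint]

theorem sidePoint_one (i : Fin 3) : sidePoint i 1 = triangleVertex (i + 1) := by
  ext j
  simp [sidePoint]

theorem triangleVertex_injective : Function.Injective triangleVertex :=
  stdSimplex.vertex_injective

theorem continuous_sidePoint (i : Fin 3) : Continuous (sidePoint i) := by
  unfold sidePoint
  fun_prop

theorem sidePoint_eq_triangleVertex {i j : Fin 3} {t : unitInterval}
    (h : sidePoint i t = triangleVertex j) : t = 0 ∧ j = i ∨ t = 1 ∧ j = i + 1 := by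
  have hc : ∀ k, (1 - (t : ℝ)) * (Pi.single i 1 : Fin 3 → ℝ) k +
      (t : ℝ) * (Pi.single (i + 1) 1 : Fin 3 → ℝ) k = (Pi.single j 1 : Fin 3 → ℝ) k :=
    fun k => congrFun (congrArg Subtype.val h) k
  have hj : j = i ∨ j = i + 1 ∨ j = i + 2 := by lia
  rcases hj with rfl | rfl | rfl
  · have h1 := hc (j + 1)
    have h2 : j + 1 ≠ j := by lia
    simp [h2] at h1
    exact Or.inl ⟨h1, rfl⟩
  · have h1 := hc i
    have h2 : i ≠ i + 1 := by lia
    simp [h2] at h1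
    exact Or.inr ⟨Subtype.ext (sub_eq_zero.1 h1).symm, rfl⟩
  · have h1 := hc (i + 2)
    have h2 : i + 2 ≠ i := by lia
    have h3 : i + 2 ≠ i + 1 := by lia
    simp [h2, h3] at h1

namespace SurfaceTriangulation

variable {S S' Face : Type*} [TopologicalSpace S] [TopologicalSpace S']
variable {T : SurfaceTriangulation S Face} {p : S' → S}

/-! ## The rotation of the corners of a triangulation -/

variable (T) in
/-- The corner `i` of the face `f` is followed, in the cyclic order around its vertex, by the
corner of the face on the other side of the side `i + 2` of `f`. -/
def rotation : Equiv.Perm (Face × Fin 3) where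
  toFun d := T.opp (d.1, d.2 + 2)
  invFun d := ((T.opp d).1, (T.opp d).2 + 1)
  left_inv d := by
    have : d.2 + 2 + 1 = d.2 := by lia
    simp [T.opp_opp, this]
  right_inv d := by
    have : (T.opp d).2 + 1 + 2 = (T.opp d).2 := by lia
    simp [this, T.opp_opp]

theorem rotation_opp_succ (d : Face × Fin 3) : T.rotation ((T.opp d).1, (T.opp d).2 + 1) = d :=
  T.rotation.apply_symm_apply d

theorem rotation_succ (d : Face × Fin 3) : T.rotation (d.1, d.2 + 1) = T.opp d := by
  have := rotation_opp_succ (T := T) (T.opp d)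
  rwa [T.opp_opp] at this

variable (T) in
/-- The rotation cycles of the corners whose vertex is a given point of a given face. -/
def cornerCycles (u : Face × StdTriangle) :
    Set (Quotient (Equiv.Perm.SameCycle.setoid T.rotation)) :=
  {c | ∃ i, triangleVertex i = u.2 ∧ c = Quotient.mk _ (u.1, i)}

theorem cornerCycles_triangleVertex (f : Face) (i : Fin 3) :
    T.cornerCycles (f, triangleVertex i) = {Quotient.mk _ (f, i)} := by
  ext c
  simp only [cornerCycles, Set.mem_ofPred_eq, Set.mem_singleton_iff]
  constructor
  · rintro ⟨j, hj, rfl⟩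
    rw [triangleVertex_injective hj]
  · rintro rfl
    exact ⟨i, rfl, rfl⟩

/-- Vertices become equal in S only through a chain of glued endpoints of sides, and each link of
the chain is one step of the rotation. Interior points of sides carry no corner, so both sets are
empty there. -/
theorem cornerCycles_eq_of_sideGlued {u v : Face × StdTriangle} (h : SideGlued T.opp u v) :
    T.cornerCycles u = T.cornerCycles v := by
  obtain ⟨d, t⟩ := h
  by_cases h0 : t = 0
  · subst h0
    rw [sidePoint_zero, unitInterval.symm_zero, sidePoint_one, cornerCycles_triangleVertex,
      cornerCycles_triangleVertex]
    congr 1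
    refine Quotient.sound ?_
    change T.rotation.SameCycle _ _
    have := rotation_opp_succ (T := T) d
    exact Equiv.Perm.SameCycle.symm ⟨1, by rw [zpow_one, this]⟩
  by_cases h1 : t = 1
  · subst h1
    rw [sidePoint_one, unitInterval.symm_one, sidePoint_zero, cornerCycles_triangleVertex,
      cornerCycles_triangleVertex]
    congr 1
    refine Quotient.sound ?_
    change T.rotation.SameCycle _ _
    exact ⟨1, by rw [zpow_one, rotation_succ]⟩
  have empty : ∀ (f : Face) (i : Fin 3) (t : unitInterval), t ≠ 0 → t ≠ 1 →
      T.cornerCycles (f, sidePoint i t) = ∅ := by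
    intro f i t h0 h1
    refine Set.eq_empty_of_forall_notMem ?_
    rintro c ⟨j, hj, -⟩
    rcases sidePoint_eq_triangleVertex hj.symm with h | h
    exacts [h0 h.1, h1 h.1]
  rw [empty _ _ _ h0 h1, empty]
  · rwa [Ne, unitInterval.symm_eq_zero]
  · rwa [Ne, unitInterval.symm_eq_one]

/-- Two corners of a triangulation with the same vertex are in the same rotation cycle. -/
theorem sameCycle_rotation {d e : Face × Fin 3}
    (h : T.charMap d.1 (triangleVertex d.2) = T.charMap e.1 (triangleVertex e.2)) :
    T.rotation.SameCycle d e := by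
  have h1 := (T.charMap_eq_iff _ _ _ _).1 h
  have key : ∀ u v, Relation.EqvGen (SideGlued T.opp) u v →
      T.cornerCycles u = T.cornerCycles v := by
    intro u v huv
    induction huv with
    | rel _ _ h => exact cornerCycles_eq_of_sideGlued h
    | refl _ => rfl
    | symm _ _ _ ih => exact ih.symm
    | trans _ _ _ _ _ ih₁ ih₂ => exact ih₁.trans ih₂
  have h2 := key _ _ h1
  rw [cornerCycles_triangleVertex, cornerCycles_triangleVertex, Set.singleton_eq_singleton_iff] at h2
  exact Quotient.exact h2

theorem charMap_sidePoint (d : Face × Fin 3) (t : unitInterval) :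
    T.charMap d.1 (sidePoint d.2 t) =
      T.charMap (T.opp d).1 (sidePoint (T.opp d).2 (unitInterval.symm t)) :=
  (T.charMap_eq_iff _ _ _ _).2 (.rel _ _ (.glue d t))

/-! ## Lifted faces -/

theorem exists_liftedFace (hp : IsCoveringMap p) {f : Face} {a : StdTriangle} {z : S'}
    (h : T.charMap f a = p z) : ∃ τ : T.LiftedFace p f, τ.1 a = z := by
  obtain ⟨τ, ⟨hτ, hpτ⟩, -⟩ := hp.existsUnique_continuousMap_lifts (T.charMap f) a z h.symm
  exact ⟨⟨τ, congrFun hpτ⟩, hτ⟩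

theorem LiftedFace.ext_of_apply_eq (hp : IsCoveringMap p) {f : Face} {σ τ : T.LiftedFace p f}
    {a : StdTriangle} (h : σ.1 a = τ.1 a) : σ = τ :=
  Subtype.ext (DFunLike.coe_injective (hp.eq_of_comp_eq σ.1.continuous τ.1.continuous
    (funext fun a => (σ.2 a).trans (τ.2 a).symm) a h))

/-- Both sides of the equation lift the same path in S; agreement at one parameter propagates along
the whole side. -/
theorem LiftedFace.apply_sidePoint_opp (hp : IsCoveringMap p) (d : Face × Fin 3)
    (σ : T.LiftedFace p d.1) (τ : T.LiftedFace p (T.opp d).1) {t₀ : unitInterval}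
    (h : σ.1 (sidePoint d.2 t₀) = τ.1 (sidePoint (T.opp d).2 (unitInterval.symm t₀)))
    (t : unitInterval) :
    σ.1 (sidePoint d.2 t) = τ.1 (sidePoint (T.opp d).2 (unitInterval.symm t)) :=
  congrFun (hp.eq_of_comp_eq (g₁ := fun t => σ.1 (sidePoint d.2 t))
    (g₂ := fun t => τ.1 (sidePoint (T.opp d).2 (unitInterval.symm t)))
    (σ.1.continuous.comp (continuous_sidePoint _))
    (τ.1.continuous.comp ((continuous_sidePoint _).comp unitInterval.continuous_symm))
    (funext fun t => (σ.2 _).trans ((charMap_sidePoint d t).trans (τ.2 _).symm)) t₀ h) t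

/-- The translate of a lifted face by a deck transformation. -/
def LiftedFace.deck (g : DeckGroup p) {f : Face} (σ : T.LiftedFace p f) : T.LiftedFace p f :=
  ⟨⟨fun a => g.1 (σ.1 a), g.1.continuous.comp σ.1.continuous⟩, fun a => (g.2 _).trans (σ.2 a)⟩

theorem LiftedVertex.deck_mul (g h : DeckGroup p) (z : T.LiftedVertex p) :
    z.deck (g * h) = (z.deck h).deck g := rfl

theorem LiftedVertex.deck_one (z : T.LiftedVertex p) : z.deck 1 = z := rfl

theorem LiftedVertex.deck_injective_left [PreconnectedSpace S'] (hp : IsCoveringMap p)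
    {g h : DeckGroup p} {z : T.LiftedVertex p} (hz : z.deck g = z.deck h) : g = h :=
  hp.deckGroup_ext (congrArg Subtype.val hz)

/-! ## Corners at a vertex of the lifted triangulation -/

namespace Corner

variable {x : T.LiftedVertex p}

/-- The corner of the triangulation below a corner of the lifted triangulation. -/
def proj (κ : Corner x) : Face × Fin 3 := (κ.face, κ.idx)

theorem proj_injective (hp : IsCoveringMap p) : Function.Injective (proj (x := x)) := by
  rintro ⟨f, σ, i, h⟩ ⟨g, τ, j, h'⟩ e
  obtain ⟨rfl, rfl⟩ := Prod.mk.inj e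
  obtain rfl : σ = τ := LiftedFace.ext_of_apply_eq hp (congrArg Subtype.val (h.trans h'.symm))
  rfl

theorem charMap_proj (κ : Corner x) :
    T.charMap κ.proj.1 (triangleVertex κ.proj.2) = p x.1 :=
   (κ.lift.2 _).symm.trans (congrArg (fun z => p z.1) κ.vertex_eq)

theorem exists_proj_eq (hp : IsCoveringMap p) {d : Face × Fin 3}
    (h : T.charMap d.1 (triangleVertex d.2) = p x.1) : ∃ κ : Corner x, κ.proj = d := by
  obtain ⟨τ, hτ⟩ := exists_liftedFace hp h
  exact ⟨⟨d.1, τ, d.2, Subtype.ext hτ⟩, rfl⟩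

theorem nonempty (hp : IsCoveringMap p) (x : T.LiftedVertex p) : Nonempty (Corner x) := by
  obtain ⟨f, i, h⟩ := x.2
  exact (exists_proj_eq hp (d := (f, i)) h).nonempty

theorem exists_proj_eq_rotation (hp : IsCoveringMap p) (κ : Corner x) :
    ∃ κ' : Corner x, κ'.proj = T.rotation κ.proj := by
  refine exists_proj_eq hp ?_
  -- Side `idx + 2` ends at vertex `idx` (modulo 3), and the side glued to it starts there.
  have h := charMap_sidePoint (T := T) (κ.face, κ.idx + 2) 1
  have h3 : κ.idx + 2 + 1 = κ.idx := by lia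
  rw [sidePoint_one, unitInterval.symm_one, sidePoint_zero, h3] at h
  exact h.symm.trans κ.charMap_proj

theorem neighbour_eq_nextNeighbour (hp : IsCoveringMap p) {κ κ' : Corner x}
    (h : κ'.proj = T.rotation κ.proj) : κ'.neighbour = κ.nextNeighbour := by
  obtain ⟨f, τ, j, hj⟩ := κ'
  obtain ⟨rfl, rfl⟩ := Prod.mk.inj h
  have h3 : κ.idx + 2 + 1 = κ.idx := by lia
  refine Subtype.ext ?_
  have key := LiftedFace.apply_sidePoint_opp hp (κ.face, κ.idx + 2) κ.lift τ (t₀ := 1) (by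
    rw [sidePoint_one, unitInterval.symm_one, sidePoint_zero, h3]
    exact congrArg Subtype.val (κ.vertex_eq.trans hj.symm)) 0
  rw [sidePoint_zero, unitInterval.symm_zero, sidePoint_one] at key
  exact key.symm

/-- The corners at a vertex are permuted cyclically by the rotation around the vertex. -/
theorem exists_rotation [Finite Face] (hp : IsCoveringMap p) (x : T.LiftedVertex p) :
    ∃ σ : Equiv.Perm (Corner x), (∀ κ κ', σ.SameCycle κ κ') ∧
      ∀ κ, (σ κ).neighbour = κ.nextNeighbour := by
  have : Finite (Corner x) := finite_corner hp x
  choose r hr using fun κ : Corner x => exists_proj_eq_rotation hp κ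
  have hinj : Function.Injective r := fun κ κ' h => by
    refine proj_injective hp (T.rotation.injective ?_)
    rw [← hr, ← hr, h]
  let σ : Equiv.Perm (Corner x) := Equiv.ofBijective r (Finite.injective_iff_bijective.1 hinj)
  have hσ : ∀ (n : ℕ) (κ : Corner x), ((σ ^ n) κ).proj = (T.rotation ^ n) κ.proj := by
    intro n κ
    induction n with
    | zero => rfl
    | succ n ih =>
      rw [pow_succ', pow_succ', Equiv.Perm.mul_apply, Equiv.Perm.mul_apply, ← ih]
      exact hr _
  refine ⟨σ, fun κ κ' => ?_, fun κ => neighbour_eq_nextNeighbour hp (hr κ)⟩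
  obtain ⟨n, hn⟩ :=
    (sameCycle_rotation (κ.charMap_proj.trans κ'.charMap_proj.symm)).exists_nat_pow_eq
  refine ⟨n, proj_injective hp ?_⟩
  rw [zpow_natCast, hσ, hn]

/-- A corner is a translate of the corner of any other lift of its face. -/
theorem exists_deck_eq [SimplyConnectedSpace S'] [LocallyPathConnectedSpace S']
    (hp : IsCoveringMap p) (κ : Corner x) (τ : T.LiftedFace p κ.face) :
    ∃ g : DeckGroup p, ∀ i, (τ.vertex i).deck g = κ.lift.vertex i := by
  obtain ⟨g, hg⟩ := hp.exists_deckGroup_apply_eq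
    (z := τ.1 (triangleVertex κ.idx)) (z' := x.1) ((τ.2 _).trans κ.charMap_proj)
  refine ⟨g, fun i => ?_⟩
  have : τ.deck g = κ.lift := LiftedFace.ext_of_apply_eq hp (a := triangleVertex κ.idx)
    (hg.trans (congrArg Subtype.val κ.vertex_eq).symm)
  rw [← this]
  rfl

end Corner

end SurfaceTriangulation

/-! ### Minimality of the energy and first variation of side lengths -/

/-- The first order condition at a minimum of a sum of squares of lengths, given upper bounds for
the first variation of the lengths. -/
theorem sum_mul_nonpos_of_first_variation {ι : Type*} [Fintype ι] {ℓ r : ι → ℝ} {e : ℝ → ι → ℝ}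
    (he : ∀ t i, 0 ≤ e t i) (hmin : ∀ t, ∑ i, ℓ i ^ 2 ≤ ∑ i, e t i ^ 2)
    (h : ∀ i, ∀ M < r i, ∀ᶠ t in 𝓝[>] (0 : ℝ), e t i ≤ ℓ i - t * M) : ∑ i, ℓ i * r i ≤ 0 := by
  have main : ∀ m : ι → ℝ, (∀ i, m i < r i) → ∑ i, ℓ i * m i ≤ 0 := by
    intro m hm
    have hlim : Tendsto (fun t : ℝ => t * ((∑ i, m i ^ 2) / 2)) (𝓝[>] 0) (𝓝 0) := by
      have : Tendsto (fun t : ℝ => t * ((∑ i, m i ^ 2) / 2)) (𝓝 0)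
          (𝓝 (0 * ((∑ i, m i ^ 2) / 2))) :=
        (continuous_id.mul continuous_const).tendsto 0
      rw [zero_mul] at this
      exact this.mono_left nhdsWithin_le_nhds
    refine ge_of_tendsto hlim ?_
    filter_upwards [eventually_all.2 fun i => h i (m i) (hm i), self_mem_nhdsWithin] with t ht ht0
    have ht0 : 0 < t := ht0
    have h1 : ∑ i, ℓ i ^ 2 ≤ ∑ i, (ℓ i - t * m i) ^ 2 :=
      (hmin t).trans (Finset.sum_le_sum fun i _ => pow_le_pow_left₀ (he t i) (ht i) 2)
    have h2 : ∑ i, (ℓ i - t * m i) ^ 2 =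
        ∑ i, ℓ i ^ 2 - 2 * t * ∑ i, ℓ i * m i + t ^ 2 * ∑ i, m i ^ 2 := by
      rw [Finset.mul_sum, Finset.mul_sum, ← Finset.sum_sub_distrib, ← Finset.sum_add_distrib]
      exact Finset.sum_congr rfl fun i _ => by ring
    rw [h2] at h1
    have h3 : t * (∑ i, ℓ i * m i) ≤ t * (t * ((∑ i, m i ^ 2) / 2)) := by linarith
    exact le_of_mul_le_mul_left h3 ht0
  -- The length bounds hold only for rates strictly below r, so r is approached by r - ε.
  have hlim : Tendsto (fun ε : ℝ => ∑ i, ℓ i * (r i - ε)) (𝓝[>] 0) (𝓝 (∑ i, ℓ i * r i)) := by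
    have : Tendsto (fun ε : ℝ => ∑ i, ℓ i * (r i - ε)) (𝓝 0) (𝓝 (∑ i, ℓ i * (r i - 0))) :=
      (by fun_prop : Continuous fun ε : ℝ => ∑ i, ℓ i * (r i - ε)).tendsto 0
    simp only [sub_zero] at this
    exact this.mono_left nhdsWithin_le_nhds
  refine le_of_tendsto hlim ?_
  filter_upwards [self_mem_nhdsWithin] with ε hε
  exact main _ fun i => sub_lt_self _ hε

namespace SurfaceTriangulation

variable {S S' Face : Type*} [TopologicalSpace S] [TopologicalSpace S']
variable {T : SurfaceTriangulation S Face} {p : S' → S}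
variable {X : Type*} [MetricSpace X]

open Classical in
/-- The equivariant map obtained from `F` by moving the value at `x` to `q`. -/
def equivariantUpdate (ρ : DeckGroup p →* (X ≃ᵢ X)) (F : T.LiftedVertex p → X)
    (x : T.LiftedVertex p) (q : X) (z : T.LiftedVertex p) : X :=
  if h : ∃ g : DeckGroup p, x.deck g = z then ρ h.choose q else F z

section Update

variable {ρ : DeckGroup p →* (X ≃ᵢ X)} {F : T.LiftedVertex p → X} {x : T.LiftedVertex p}

theorem equivariantUpdate_of_not (q : X) {z : T.LiftedVertex p}
    (h : ¬ ∃ g : DeckGroup p, x.deck g = z) : equivariantUpdate ρ F x q z = F z :=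
  dif_neg h

variable [PreconnectedSpace S']

/-- Deck transformations act freely, so the chosen one is g itself. -/
theorem equivariantUpdate_deck (hp : IsCoveringMap p) (q : X) (g : DeckGroup p) :
    equivariantUpdate ρ F x q (x.deck g) = ρ g q := by
  have h : ∃ g' : DeckGroup p, x.deck g' = x.deck g := ⟨g, rfl⟩
  rw [equivariantUpdate, dif_pos h, LiftedVertex.deck_injective_left hp h.choose_spec]

theorem isEquivariant_equivariantUpdate (hp : IsCoveringMap p) (hF : IsEquivariant ρ F) (q : X) :
    IsEquivariant ρ (equivariantUpdate ρ F x q) := by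
  intro g z
  by_cases h : ∃ g' : DeckGroup p, x.deck g' = z
  · obtain ⟨g', rfl⟩ := h
    rw [← LiftedVertex.deck_mul, equivariantUpdate_deck hp, equivariantUpdate_deck hp, map_mul]
    rfl
  · rw [equivariantUpdate_of_not q h, equivariantUpdate_of_not q, hF]
    rintro ⟨g', hg'⟩
    refine h ⟨g⁻¹ * g', ?_⟩
    rw [LiftedVertex.deck_mul, hg', ← LiftedVertex.deck_mul, inv_mul_cancel,
      LiftedVertex.deck_one]

end Update

theorem IsEquivariant.dist_deck {ρ : DeckGroup p →* (X ≃ᵢ X)} {F : T.LiftedVertex p → X}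
    (hF : IsEquivariant ρ F) (g : DeckGroup p) (z w : T.LiftedVertex p) :
    dist (F (z.deck g)) (F (w.deck g)) = dist (F z) (F w) := by
  rw [hF, hF, (ρ g).dist_eq]

theorem FlattensNoEdge.vertex_ne {F : T.LiftedVertex p → X} (hF : FlattensNoEdge F) {f : Face}
    (σ : T.LiftedFace p f) {i j : Fin 3} (hij : i ≠ j) : F (σ.vertex i) ≠ F (σ.vertex j) := by
  have h : j = i + 1 ∨ i = j + 1 := by lia
  rcases h with rfl | rfl
  · exact dist_ne_zero.1 (hF f σ i)
  · exact (dist_ne_zero.1 (hF f σ j)).symm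

section FirstVariation

variable (F : T.LiftedVertex p → X)

open Classical in
/-- The rate of decrease of the length of the side from the corner `d` to the vertex `j` of the
same face, as the value of `F` at `x` moves, with its orbit, towards `y`: only the motion of the
vertex at `d` is taken into account. -/
def cornerRate (x : T.LiftedVertex p) [Fintype (Corner x)] (y : X) (d : Face × Fin 3) (j : Fin 3) : ℝ :=
  ∑ κ : Corner x, if κ.proj = d then Real.cos (alexandrovAngle (F x) y (F (κ.lift.vertex j))) else 0

variable {F} {x : T.LiftedVertex p}

theorem cornerRate_proj [Fintype (Corner x)] (hp : IsCoveringMap p) (y : X) (κ : Corner x)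
    (j : Fin 3) :
    cornerRate F x y κ.proj j = Real.cos (alexandrovAngle (F x) y (F (κ.lift.vertex j))) := by
  classical
  rw [cornerRate, Finset.sum_eq_single κ, if_pos rfl]
  · intro κ' _ h
    exact if_neg fun h' => h (Corner.proj_injective hp h')
  · exact fun h => absurd (Finset.mem_univ _) h

theorem cornerRate_of_not [Fintype (Corner x)] (y : X) {d : Face × Fin 3}
    (h : ∀ κ : Corner x, κ.proj ≠ d) (j : Fin 3) : cornerRate F x y d j = 0 :=
  Finset.sum_eq_zero fun κ _ => if_neg (h κ)

/-- Passes from sums over the corners of all faces of T, as in the energy, to sums over the corners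
at x. -/
theorem sum_mul_cornerRate [Fintype Face] [Fintype (Corner x)] (y : X) (w : Face × Fin 3 → ℝ)
    (j : Face × Fin 3 → Fin 3) :
    ∑ d, w d * cornerRate F x y d (j d) = ∑ κ : Corner x,
      w κ.proj * Real.cos (alexandrovAngle (F x) y (F (κ.lift.vertex (j κ.proj)))) := by
  classical
  simp only [cornerRate, Finset.mul_sum]
  rw [Finset.sum_comm]
  refine Finset.sum_congr rfl fun κ _ => ?_
  simp only [mul_ite, mul_zero, Finset.sum_ite_eq, Finset.mem_univ, if_true]

variable [SimplyConnectedSpace S'] [LocallyPathConnectedSpace S'] {ρ : DeckGroup p →* (X ≃ᵢ X)}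

/-- First variation of the distance from a moving vertex to a near point of a side. -/
theorem eventually_dist_equivariantUpdate_le [Fintype (Corner x)] (hp : IsCoveringMap p)
    (hX : IsCATNegOne X) (hF : IsEquivariant ρ F) (hflat : FlattensNoEdge F) {y : X}
    (hy : F x ≠ y) {f : Face} (τ : T.LiftedFace p f) {i j : Fin 3} (hij : i ≠ j) {c : ℝ → X}
    (hc : IsGeodesicFromTo c (F (τ.vertex i)) (F (τ.vertex j))) {M : ℝ}
    (hM : M < cornerRate F x y (f, i) j) :
    ∀ᶠ s in 𝓝[>] (0 : ℝ), ∀ᶠ t in 𝓝[>] (0 : ℝ),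
      dist (equivariantUpdate ρ F x (geodesicSegment (F x) y t) (τ.vertex i)) (c s) ≤
        s - t * M := by
  by_cases h : ∃ κ : Corner x, κ.proj = (f, i)
  · obtain ⟨κ, hκ⟩ := h
    obtain ⟨rfl, rfl⟩ := Prod.mk.inj hκ
    -- Translating by g moves the side to one issuing from x, where the first variation inequality
    -- applies.
    obtain ⟨g, hg⟩ := κ.exists_deck_eq hp τ
    have hvi := (hg κ.idx).trans κ.vertex_eq
    have hc' := hc.comp_isometryEquiv (ρ g)
    rw [← hF, ← hF, hvi, hg] at hc'
    have hne : F x ≠ F (κ.lift.vertex j) := by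
      have := hflat.vertex_ne κ.lift hij
      rwa [κ.vertex_eq] at this
    rw [show (κ.face, κ.idx) = κ.proj from rfl, cornerRate_proj hp] at hM
    have hx : τ.vertex κ.idx = x.deck g⁻¹ := by
      have h := congrArg (LiftedVertex.deck g⁻¹) hvi
      rwa [← LiftedVertex.deck_mul, inv_mul_cancel, LiftedVertex.deck_one] at h
    have key := hX.eventually_dist_le_sub (hX.isGeodesicFromTo_geodesicSegment (F x) y) hc'
      hy hne hM
    refine key.mono fun s hs => hs.mono fun t ht => ?_
    rw [hx, equivariantUpdate_deck hp, ← (ρ g).dist_eq, ← IsometryEquiv.mul_apply, ← map_mul,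
      mul_inv_cancel, map_one]
    exact ht
  · push Not at h
    rw [cornerRate_of_not y h] at hM
    have hx : ¬ ∃ g : DeckGroup p, x.deck g = τ.vertex i := by
      rintro ⟨g, hg⟩
      obtain ⟨κ, hκ⟩ := Corner.exists_proj_eq hp (x := x) (d := (f, i))
        ((τ.2 _).symm.trans ((congrArg (fun z => p z.1) hg).symm.trans (g.2 _)))
      exact h κ hκ
    -- The vertex is outside the orbit of x and stays fixed: the distance remains s, while M < 0.
    filter_upwards [IsCATNegOne.eventually_mem_Icc (hflat.vertex_ne τ hij)] with s hs
    filter_upwards [self_mem_nhdsWithin] with t ht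
    have ht : 0 < t := ht
    rw [equivariantUpdate_of_not _ hx, hc.dist_left hs]
    nlinarith

/-- First variation of the length of a side. -/
theorem eventually_sideLength_equivariantUpdate_le [Fintype (Corner x)] (hp : IsCoveringMap p)
    (hX : IsCATNegOne X) (hF : IsEquivariant ρ F) (hflat : FlattensNoEdge F) {y : X}
    (hy : F x ≠ y) {f : Face} (τ : T.LiftedFace p f) (i : Fin 3) {M : ℝ}
    (hM : M < cornerRate F x y (f, i) (i + 1) + cornerRate F x y (f, i + 1) i) :
    ∀ᶠ t in 𝓝[>] (0 : ℝ),
      sideLength (equivariantUpdate ρ F x (geodesicSegment (F x) y t)) τ i ≤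
        sideLength F τ i - t * M := by
  have hij : i ≠ i + 1 := by lia
  have hne := hflat.vertex_ne τ hij
  have hc := hX.isGeodesicFromTo_geodesicSegment (F (τ.vertex i)) (F (τ.vertex (i + 1)))
  -- Both ends may move, since both may lie in the orbit of x. Two fixed points of the side at
  -- distance s from its ends decouple the two motions, and each end receives half of the slack.
  obtain ⟨ε, hε⟩ : ∃ ε, ε = (cornerRate F x y (f, i) (i + 1) + cornerRate F x y (f, i + 1) i - M) / 2 :=
    ⟨_, rfl⟩
  have h1 := eventually_dist_equivariantUpdate_le hp hX hF hflat hy τ hij hc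
    (M := cornerRate F x y (f, i) (i + 1) - ε) (by linarith)
  have h2 := eventually_dist_equivariantUpdate_le hp hX hF hflat hy τ hij.symm hc.reverse
    (M := cornerRate F x y (f, i + 1) i - ε) (by linarith)
  obtain ⟨s, ⟨hs1, hs2⟩, hs⟩ :=
    ((h1.and h2).and (Ioo_mem_nhdsGT (half_pos (dist_pos.2 hne)))).exists
  filter_upwards [hs1, hs2] with t ht1 ht2
  have hd := hc.2.2 s ⟨hs.1.le, by linarith [hs.2]⟩
    (dist (F (τ.vertex i)) (F (τ.vertex (i + 1))) - s)
    ⟨by linarith [hs.1, hs.2], by linarith [hs.1]⟩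
  rw [abs_sub_comm, abs_of_nonneg (by linarith [hs.2])] at hd
  rw [dist_comm] at ht2
  refine (dist_triangle4 _ _ _ _).trans ((add_le_add (add_le_add ht1 hd.le) ht2).trans (le_of_eq ?_))
  rw [sideLength, show M = cornerRate F x y (f, i) (i + 1) + cornerRate F x y (f, i + 1) i - 2 * ε
    by linarith]
  ring

/-- The values of a harmonic map at the neighbours of `x` are balanced around the value at `x`. -/
theorem IsHarmonic.sum_mul_cos_nonpos [Fintype Face] [Fintype (Corner x)] (hp : IsCoveringMap p)
    (hX : IsCATNegOne X) {D : T.FundamentalDomain p} (hF : IsHarmonic D ρ F)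
    (hflat : FlattensNoEdge F) {y : X} (hy : F x ≠ y) :
    ∑ κ : Corner x, dist (F x) (F κ.neighbour) *
      Real.cos (alexandrovAngle (F x) y (F κ.neighbour)) ≤ 0 := by
  have key := sum_mul_nonpos_of_first_variation (ι := Face × Fin 3)
    (ℓ := fun d => sideLength F (D d.1) d.2)
    (r := fun d => cornerRate F x y d (d.2 + 1) + cornerRate F x y (d.1, d.2 + 1) d.2)
    (e := fun t d =>
      sideLength (equivariantUpdate ρ F x (geodesicSegment (F x) y t)) (D d.1) d.2)
    (fun _ _ => dist_nonneg)
    (fun t => by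
      have h := hF.2 _ (isEquivariant_equivariantUpdate (x := x) hp hF.1
        (geodesicSegment (F x) y t))
      rw [energy, energy] at h
      simp only [Fintype.sum_prod_type]
      linarith)
    (fun d M hM =>
      eventually_sideLength_equivariantUpdate_le hp hX hF.1 hflat hy (D d.1) d.2 hM)
  obtain ⟨σ, -, hσ⟩ := Corner.exists_rotation hp x
  -- Reindexes each side by the corner where it ends instead of the one where it starts.
  have hshift : ∑ d : Face × Fin 3,
      sideLength F (D d.1) d.2 * cornerRate F x y (d.1, d.2 + 1) d.2 =
      ∑ d : Face × Fin 3, dist (F ((D d.1).vertex d.2)) (F ((D d.1).vertex (d.2 + 2))) *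
        cornerRate F x y d (d.2 + 2) := by
    refine Fintype.sum_equiv ((Equiv.refl Face).prodCongr (Equiv.addRight (1 : Fin 3))) _ _ ?_
    rintro ⟨f, i⟩
    have h3 : i + 1 + 2 = i := by lia
    simp only [Equiv.prodCongr_apply, Prod.map_apply, Equiv.refl_apply, Equiv.coe_addRight, h3]
    rw [sideLength, dist_comm]
    rfl
  have hdist : ∀ (κ : Corner x) (j : Fin 3),
      dist (F ((D κ.face).vertex κ.idx)) (F ((D κ.face).vertex j)) =
        dist (F x) (F (κ.lift.vertex j)) := by
    intro κ j
    obtain ⟨g, hg⟩ := κ.exists_deck_eq hp (D κ.face)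
    rw [← hF.1.dist_deck g, hg, hg, κ.vertex_eq]
  simp only [mul_add, Finset.sum_add_distrib] at key
  rw [hshift, sum_mul_cornerRate, sum_mul_cornerRate] at key
  have e1 : ∑ κ : Corner x, sideLength F (D κ.proj.1) κ.proj.2 *
      Real.cos (alexandrovAngle (F x) y (F (κ.lift.vertex (κ.proj.2 + 1)))) =
      ∑ κ : Corner x, dist (F x) (F κ.neighbour) *
        Real.cos (alexandrovAngle (F x) y (F κ.neighbour)) :=
    Finset.sum_congr rfl fun κ _ => by
      rw [← show _ = dist (F x) (F κ.neighbour) from hdist κ (κ.idx + 1)]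
      rfl
  -- The side arriving at a corner is the side issuing from the next corner in the rotation, so this
  -- sum equals the previous one and `key` is twice the claim.
  have e2 : ∑ κ : Corner x, dist (F ((D κ.proj.1).vertex κ.proj.2))
        (F ((D κ.proj.1).vertex (κ.proj.2 + 2))) *
      Real.cos (alexandrovAngle (F x) y (F (κ.lift.vertex (κ.proj.2 + 2)))) =
      ∑ κ : Corner x, dist (F x) (F κ.neighbour) *
        Real.cos (alexandrovAngle (F x) y (F κ.neighbour)) := by
    rw [← Equiv.sum_comp σ (fun κ : Corner x => dist (F x) (F κ.neighbour) *
        Real.cos (alexandrovAngle (F x) y (F κ.neighbour)))]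
    refine Finset.sum_congr rfl fun κ _ => ?_
    rw [hσ, ← show _ = dist (F x) (F κ.nextNeighbour) from hdist κ (κ.idx + 2)]
    rfl
  rw [e1, e2] at key
  linarith

end FirstVariation

end SurfaceTriangulation

end

theorem mainTheorem3
    {S : Type*} [TopologicalSpace S] [T2Space S] [CompactSpace S] [ConnectedSpace S]
    [ChartedSpace (EuclideanSpace ℝ (Fin 2)) S]
    {S' : Type*} [TopologicalSpace S'] [SimplyConnectedSpace S']
    {p : S' → S} (hp : IsCoveringMap p)
    {Face : Type*} [Fintype Face] (T : SurfaceTriangulation S Face)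
    (D : T.FundamentalDomain p)
    {X : Type*} [MetricSpace X] [CompleteSpace X] (hX : IsCATNegOne X)
    (ρ : DeckGroup p →* (X ≃ᵢ X))
    (F : T.LiftedVertex p → X)
    (hF : SurfaceTriangulation.IsHarmonic D ρ F)
    (hflat : SurfaceTriangulation.FlattensNoEdge F)
    (x : T.LiftedVertex p) :
    2 * Real.pi ≤ SurfaceTriangulation.angleSum F x := by
  have : LocallyPathConnectedSpace S :=
    ChartedSpace.locallyPathConnectedSpace (EuclideanSpace ℝ (Fin 2)) S
  have : LocallyPathConnectedSpace S' := hp.isLocalHomeomorph.locallyPathConnectedSpace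
  have : Finite (SurfaceTriangulation.Corner x) := SurfaceTriangulation.finite_corner hp x
  have : Fintype (SurfaceTriangulation.Corner x) := Fintype.ofFinite _
  have : Nonempty (SurfaceTriangulation.Corner x) := SurfaceTriangulation.Corner.nonempty hp x
  obtain ⟨σ, hcyc, hσ⟩ := SurfaceTriangulation.Corner.exists_rotation hp x
  have hne : ∀ κ : SurfaceTriangulation.Corner x, F x ≠ F κ.neighbour := fun κ => by
    have hij : κ.idx ≠ κ.idx + 1 := by lia
    have := hflat.vertex_ne κ.lift hij
    rwa [κ.vertex_eq] at this
  -- The polygon has one direction per corner, with angles as distances and edge lengths as weights.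
  have key := two_pi_le_sum_of_balanced σ hcyc
    (fun κ κ' => alexandrovAngle (F x) (F κ.neighbour) (F κ'.neighbour))
    (fun κ κ' => (hX.alexandrovAngle_mem (hne κ) (hne κ')).1)
    (fun κ => hX.alexandrovAngle_self (hne κ)) (fun _ _ => alexandrovAngle_comm _ _ _)
    (fun κ κ' κ'' => hX.alexandrovAngle_triangle (hne κ) (hne κ') (hne κ''))
    (ℓ := fun κ => dist (F x) (F κ.neighbour)) (fun κ => dist_pos.2 (hne κ))
    (fun κ => hF.sum_mul_cos_nonpos hp hX hflat (hne κ))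
  simp only [hσ] at key
  rwa [SurfaceTriangulation.angleSum, finsum_eq_sum_of_fintype]
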